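/- **Setting.** A power grid has buses $\mathcal N=\{1,\dots,N\}$, undirected transmission lines without loops ($\mathcal L\subseteq\mathcal N\times\mathcal N$ contains both orientations of each line) and symmetric line admittances $y_{k,l}=g_{k,l}+j\,b_{k,l}$, zero if $(k,l)\notin\mathcal L$. Its admittance matrix $Y=G+jB$ has entries $Y_{k,k}=\sum_{l\ne k}y_{k,l}$ and $Y_{k,l}=-y_{k,l}$ for $k\neq l$. Bus $k$ has the state $x_k=(\theta_k,v_k,p_k,q_k)\in\mathbb R^4$; write $\theta_{k,l}=\theta_k-\theta_l$. The power-flow equations are, for all buses $k$, $$0=p_k-v_k\sum_l v_l\,(G_{k,l}\cos\theta_{k,l}+B_{k,l}\sin\theta_{k,l}),\qquad 0=q_k-v_k\sum_l v_l\,(G_{k,l}\sin\theta_{k,l}-B_{k,l}\cos\theta_{k,l}).$$ For a line $(k,l)$ let $f=(f_p,f_q,f_i)$ with $$f_p=v_k^2g_{k,l}-v_kv_l(g_{k,l}\cos\theta_{k,l}+b_{k,l}\sin\theta_{k,l}),\quad f_q=-v_k^2b_{k,l}+v_kv_l(b_{k,l}\cos\theta_{k,l}-g_{k,l}\sin\theta_{k,l}),\quad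 f_i=\frac{f_p^2+f_q^2}{v_k^2}.$$ Given symmetric weight matrices $\Sigma_k\in\mathbb R^{4\times4}$, $W_{k,l}\in\mathbb R^{3\times3}$ and measured values $\hat x_k\in\mathbb R^4$, $\hat w_{k,l}\in\mathbb R^3$, the measurement function $\mathcal F(x)$ of a grid collects all $\Sigma_k^{1/2}(x_k-\hat x_k)$ and all $W_{k,l}^{1/2}(f(x_k,x_l)-\hat w_{k,l})$, $(k,l)\in\mathcal L$. The buses are divided into disjoint regions $i=1,\dots,R$. Every line $\{m,n\}$ joining two different regions is cut in the middle: a new auxiliary bus is attached to $m$ (in the region of $m$) and another one to $n$ (in the region of $n$), each by a line of admittance $2y_{m,n}$; these two buses form an auxiliary pair. This turns each region $i$ into a grid of its own, with state $z_i$, measurement function $\mathcal F_i$ and power-flow equations $\mathcal H_i(z_i)=0$. The conditions $\theta_k=\theta_l$, $v_k=v_l$ for all auxiliary pairs $(k,l)$ are written $\sum_iA_iz_i=0$. The distributed state estimation problem is $$\min_z\ \sum_i\|\mathcal F_i(z_i)\|_2^2\quad\text{s.t.}\quad\sum_iA_iz_i=0\ \ (\text{multiplier }\lambda),\qquad\mathcal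 H_i(z_i)=0\text{ for all }i\ \ (\text{multipliers }\kappa_i).\tag{1}$$ A step of Gauss–Newton ALADIN with parameter $\rho>0$ maps $(z,\lambda)$ to $(z^+,\lambda^+)$ as follows. (a) For each $i$ let $y_i$ be a local solution of $\min_{y_i}\|\mathcal F_i(y_i)\|_2^2+\lambda^\top A_iy_i+\frac\rho2\|y_i-z_i\|_2^2$ s.t. $\mathcal H_i(y_i)=0$, and let $b_i=\mathcal F_i(y_i)$, and $B_i$, $C_i$ be the Jacobians of $\mathcal F_i$, $\mathcal H_i$ at $y_i$. (b) Let $\Delta y$ solve $$\min_{\Delta y}\ \sum_i\|B_i\Delta y_i\|_2^2+2\,\Delta y_i^\top B_i^\top b_i\quad\text{s.t.}\quad\sum_iA_i(y_i+\Delta y_i)=0\ \ (\text{multiplier }\lambda^{\mathrm{QP}}),\qquad C_i\Delta y_i=0\text{ for all }i,$$ and set $z^+=y+\Delta y$, $\lambda^+=\lambda^{\mathrm{QP}}$. **Theorem.** Fix a partitioned grid, weights with all $\Sigma_k$ positive definite and all $W_{k,l}$ positive semidefinite (for all buses and lines of all regions), and a point $z^*$ such that $v_k^*\neq0$ at the ends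 of all lines of all regions and the Jacobian of the power-flow equations $(\mathcal H_i(z_i))_i$ with respect to all states has full row rank at $z^*$. Then there is a threshold $\eta>0$, depending on nothing else, such that the following holds for all measured values $\hat x,\hat w$ for which $z^*$ is a local minimizer of (1), with multipliers $\lambda^*,\kappa^*$ making the gradient of the Lagrangian vanish, and $\sum_i\|\mathcal F_i(z_i^*)\|_2^2\le\eta$. For every $\rho>0$ there are $r,\delta>0$ and $q\in[0,1)$ such that for every $(z,\lambda)$ at Euclidean distance less than $\delta$ from $(z^*,\lambda^*)$: * subproblem (a) has exactly one local solution $y$ with $\|y-z^*\|_2<r$, the step that uses it defines exactly one $(z^+,\lambda^+)$, and $$\left\|\begin{pmatrix}z^+-z^*\\\lambda^+-\lambda^*\end{pmatrix}\right\|_2\le q\left\|\begin{pmatrix}z-z^*\\\lambda-\lambda^*\end{pmatrix}\right\|_2;$$ * the iteration started at $(z,\lambda)$, with these local solutions in (a), is well defined for all times and unique, its iterates satisfy the above inequality at every step, and they converge to $(z^*,\lambda^*)$. -/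

import Mathlib

open Filter Topology
open scoped Matrix MatrixOrder RealInnerProductSpace

noncomputable section

/-- A power grid on the bus set `V`: the transmission lines (undirected, so both orientations of
a line are listed, and without loops) and the line admittances `y k l = g k l + j * b k l`. -/
structure Grid (V : Type) where
  lines : Finset (V × V)
  y : V → V → ℂ
  lines_symm : ∀ k l, (k, l) ∈ lines → (l, k) ∈ lines
  lines_irrefl : ∀ k, (k, k) ∉ lines
  y_symm : ∀ k l, y k l = y l k
  y_eq_zero : ∀ k l, (k, l) ∉ lines → y k l = 0

/-- Grid states `x`; bus `k` carries the voltage angle `θ k = x (k, 0)`, the voltage magnitude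
`v k = x (k, 1)`, and the net active and reactive powers `p k = x (k, 2)`, `q k = x (k, 3)`. -/
abbrev GridState (V : Type) : Type := EuclideanSpace ℝ (V × Fin 4)

namespace Grid

variable {V : Type} [Fintype V] [DecidableEq V] (G : Grid V)

/-- Line conductance. -/
def g (k l : V) : ℝ := (G.y k l).re

/-- Line susceptance. -/
def b (k l : V) : ℝ := (G.y k l).im

/-- The admittance matrix. -/
def admittance : Matrix V V ℂ :=
  Matrix.of fun k l => if k = l then ∑ m ∈ Finset.univ.erase k, G.y k m else -G.y k l

/-- The left-over of the two power-flow equations (active: `0`, reactive: `1`) at every bus; a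
state satisfies the power-flow equations if and only if `G.powerFlow x = 0`. -/
def powerFlow (x : GridState V) : EuclideanSpace ℝ (V × Fin 2) :=
  WithLp.toLp 2 fun kc =>
    ![x (kc.1, 2) - x (kc.1, 1) * ∑ l, x (l, 1) *
        ((G.admittance kc.1 l).re * Real.cos (x (kc.1, 0) - x (l, 0))
          + (G.admittance kc.1 l).im * Real.sin (x (kc.1, 0) - x (l, 0))),
      x (kc.1, 3) - x (kc.1, 1) * ∑ l, x (l, 1) *
        ((G.admittance kc.1 l).re * Real.sin (x (kc.1, 0) - x (l, 0))
          - (G.admittance kc.1 l).im * Real.cos (x (kc.1, 0) - x (l, 0)))] kc.2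

/-- Active power flow on the line from `k` to `l`. -/
def flowP (x : GridState V) (k l : V) : ℝ :=
  x (k, 1) * (x (k, 1) * G.g k l - x (l, 1) * G.g k l * Real.cos (x (k, 0) - x (l, 0)))
    - x (k, 1) * (x (l, 1) * G.b k l * Real.sin (x (k, 0) - x (l, 0)))

/-- Reactive power flow on the line from `k` to `l`. -/
def flowQ (x : GridState V) (k l : V) : ℝ :=
  -(x (k, 1) * (x (k, 1) * G.b k l - x (l, 1) * G.b k l * Real.cos (x (k, 0) - x (l, 0))))
    - x (k, 1) * (x (l, 1) * G.g k l * Real.sin (x (k, 0) - x (l, 0)))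

/-- Squared current magnitude on the line from `k` to `l`. -/
def flowI (x : GridState V) (k l : V) : ℝ :=
  (G.flowP x k l ^ 2 + G.flowQ x k l ^ 2) / x (k, 1) ^ 2

/-- Weights of a grid: one symmetric `4 × 4` matrix per bus and one symmetric `3 × 3` matrix per
line (the inverses of the variance matrices of the measurement errors). -/
structure Weights where
  bus : V → Matrix (Fin 4) (Fin 4) ℝ
  line : G.lines → Matrix (Fin 3) (Fin 3) ℝ

/-- Measured values: the four state components at every bus, and active power, reactive power and
squared current on every line. -/
structure Measurements where
  bus : V → Fin 4 → ℝ
  line : G.lines → Fin 3 → ℝ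

/-- The complete weighted measurement function `𝓕`. -/
def measure (S : G.Weights) (M : G.Measurements) (x : GridState V) :
    EuclideanSpace ℝ ((V × Fin 4) ⊕ (G.lines × Fin 3)) :=
  WithLp.toLp 2 <| Sum.elim
    (fun kc => (CFC.sqrt (S.bus kc.1) *ᵥ fun c => x (kc.1, c) - M.bus kc.1 c) kc.2)
    (fun ec => (CFC.sqrt (S.line ec.1) *ᵥ fun c =>
      ![G.flowP x ec.1.1.1 ec.1.1.2, G.flowQ x ec.1.1.1 ec.1.1.2, G.flowI x ec.1.1.1 ec.1.1.2] c
        - M.line ec.1 c) ec.2)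

end Grid

/-- A power grid with buses `1, …, N` whose bus set is divided into `R` disjoint regions; `reg k`
is the region of bus `k`. -/
structure PartitionedGrid (N R : ℕ) where
  grid : Grid (Fin N)
  reg : Fin N → Fin R

namespace PartitionedGrid

variable {N R : ℕ} (P : PartitionedGrid N R)

/-- The original buses of region `i`. -/
abbrev OrigBus (i : Fin R) : Type := {k : Fin N // P.reg k = i}

/-- The auxiliary buses of region `i`. Every line from a bus `m` of region `i` to a bus `n` of
another region is cut in the middle; `(m, n)` names the new end of the half that stays with `m`.
The new end of the half that stays with `n` is the auxiliary bus `(n, m)` of the region of `n`. -/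
abbrev AuxBus (i : Fin R) : Type :=
  {e : Fin N × Fin N // e ∈ P.grid.lines ∧ P.reg e.1 = i ∧ P.reg e.2 ≠ i}

/-- All buses of region `i`. -/
abbrev RegBus (i : Fin R) : Type := P.OrigBus i ⊕ P.AuxBus i

/-- Whether there is a line from one bus of region `i` to another: original buses keep their
lines, and the auxiliary bus `(m, n)` is linked to `m` only. -/
def regLinked (i : Fin R) : P.RegBus i → P.RegBus i → Bool
  | .inl k, .inl l => decide ((k.1, l.1) ∈ P.grid.lines)
  | .inl k, .inr e => decide (k.1 = e.1.1)
  | .inr e, .inl k => decide (k.1 = e.1.1)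
  | .inr _, .inr _ => false

/-- The line admittances of region `i`: half a line has twice the admittance of the line. -/
def regY (i : Fin R) : P.RegBus i → P.RegBus i → ℂ
  | .inl k, .inl l => P.grid.y k.1 l.1
  | .inl k, .inr e => if k.1 = e.1.1 then 2 * P.grid.y e.1.1 e.1.2 else 0
  | .inr e, .inl k => if k.1 = e.1.1 then 2 * P.grid.y e.1.1 e.1.2 else 0
  | .inr _, .inr _ => 0

/-- The power grid of region `i`. -/
def regGrid (i : Fin R) : Grid (P.RegBus i) where
  lines := Finset.univ.filter fun e => P.regLinked i e.1 e.2 = true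
  y := P.regY i
  lines_symm k l h := by
    rw [Finset.mem_filter] at h ⊢
    refine ⟨Finset.mem_univ _, ?_⟩
    replace h := h.2
    rcases k with k | k <;> rcases l with l | l <;> simp only [regLinked, decide_eq_true_eq] at h ⊢
    · exact P.grid.lines_symm _ _ h
    · exact h
    · exact h
    · exact h
  lines_irrefl k h := by
    rw [Finset.mem_filter] at h
    replace h := h.2
    rcases k with k | k
    · exact P.grid.lines_irrefl _ (of_decide_eq_true h)
    · exact Bool.noConfusion h
  y_symm k l := by
    rcases k with k | k <;> rcases l with l | l <;> simp [regY, P.grid.y_symm]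
  y_eq_zero k l h := by
    rw [Finset.mem_filter, not_and] at h
    replace h := h (Finset.mem_univ _)
    rcases k with k | k <;> rcases l with l | l <;> simp only [regLinked, decide_eq_true_eq] at h
    · exact P.grid.y_eq_zero _ _ h
    · exact if_neg h
    · exact if_neg h
    · rfl

/-- The auxiliary bus pairs, one for each line that connects two regions: `(m, n)` with `m < n`
stands for the pair of the auxiliary buses `(m, n)` and `(n, m)`. -/
abbrev AuxPair : Type :=
  {e : Fin N × Fin N // e ∈ P.grid.lines ∧ P.reg e.1 ≠ P.reg e.2 ∧ e.1 < e.2}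

/-- The states `z = (z₁, …, z_R)` of all regions. -/
abbrev States : Type := PiLp 2 fun i : Fin R => GridState (P.RegBus i)

/-- Multipliers `λ` of the consensus constraints, two for each auxiliary bus pair. -/
abbrev ConsMult : Type := EuclideanSpace ℝ (P.AuxPair × Fin 2)

/-- Multipliers `κ = (κ₁, …, κ_R)` of the power-flow equations of all regions. -/
abbrev FlowMult : Type := PiLp 2 fun i : Fin R => EuclideanSpace ℝ (P.RegBus i × Fin 2)

/-- Primal-dual iterates `(z, λ)`, with the Euclidean norm. -/
abbrev Iterate : Type := WithLp 2 (P.States × P.ConsMult)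

/-- The coupling matrix `A i`; `∑ i, A i z i = 0` says that `θ` (component `0`) and `v`
(component `1`) agree at the two buses of every auxiliary bus pair. -/
def A (i : Fin R) : Matrix (P.AuxPair × Fin 2) (P.RegBus i × Fin 4) ℝ :=
  Matrix.of fun ec kd =>
    if ec.2.val = kd.2.val then
      match kd.1 with
      | .inl _ => 0
      | .inr a => if a.1 = ec.1.1 then 1 else if a.1 = ec.1.1.swap then -1 else 0
    else 0

/-- `A i z i` as a vector of the Euclidean space of the consensus multipliers. -/
def applyA (i : Fin R) (x : GridState (P.RegBus i)) : P.ConsMult :=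
  WithLp.toLp 2 (P.A i *ᵥ x.ofLp)

/-- Weights in all regions. -/
abbrev Weights : Type := (i : Fin R) → (P.regGrid i).Weights

/-- Measured values in all regions. -/
abbrev Measurements : Type := (i : Fin R) → (P.regGrid i).Measurements

/-- The measurement function `𝓕 i` of region `i`. -/
def F (S : P.Weights) (M : P.Measurements) (i : Fin R) (x : GridState (P.RegBus i)) :
    EuclideanSpace ℝ ((P.RegBus i × Fin 4) ⊕ ((P.regGrid i).lines × Fin 3)) :=
  (P.regGrid i).measure (S i) (M i) x

/-- The power-flow equations `𝓗 i` of region `i`. -/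
def H (i : Fin R) (x : GridState (P.RegBus i)) : EuclideanSpace ℝ (P.RegBus i × Fin 2) :=
  (P.regGrid i).powerFlow x

/-- The power-flow equations of the whole partitioned network. -/
def HAll (z : P.States) : P.FlowMult := WithLp.toLp 2 fun i => P.H i (z i)

/-- The least-squares objective (the residuum). -/
def residuum (S : P.Weights) (M : P.Measurements) (z : P.States) : ℝ :=
  ∑ i, ‖P.F S M i (z i)‖ ^ 2

/-- The feasible set of the distributed state estimation problem. -/
def feasible : Set P.States :=
  {z | ∑ i, P.applyA i (z i) = 0 ∧ ∀ i, P.H i (z i) = 0}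

/-- Primal-dual locally optimal solutions of the distributed state estimation problem
`min ∑ i, ‖𝓕 i (z i)‖ ^ 2` subject to `∑ i, A i z i = 0` (multiplier `lam`) and `𝓗 i (z i) = 0`
(multipliers `kap i`): feasible local minimizers together with multipliers for which the
gradient of the Lagrangian vanishes. -/
structure IsLocalSolution (S : P.Weights) (M : P.Measurements) (z : P.States)
    (lam : P.ConsMult) (kap : P.FlowMult) : Prop where
  mem_feasible : z ∈ P.feasible
  isLocalMin : IsLocalMinOn (P.residuum S M) P.feasible z
  stationary : ∀ (i : Fin R) (d : GridState (P.RegBus i)),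
    2 * ⟪P.F S M i (z i), fderiv ℝ (P.F S M i) (z i) d⟫ + ⟪lam, P.applyA i d⟫
      + ⟪kap i, fderiv ℝ (P.H i) (z i) d⟫ = 0

/-- The parallelizable step at the iterate `s = (z, lam)`: for every region `i`, `y i` is a local
solution of `min ‖𝓕 i (y i)‖ ^ 2 + lamᵀ A i y i + ρ / 2 * ‖y i - z i‖ ^ 2` subject to
`𝓗 i (y i) = 0`. -/
def ParallelStep (S : P.Weights) (M : P.Measurements) (ρ : ℝ) (s : P.Iterate)
    (y : P.States) : Prop :=
  ∀ i, P.H i (y i) = 0 ∧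
    IsLocalMinOn
      (fun x => ‖P.F S M i x‖ ^ 2 + ⟪s.snd, P.applyA i x⟫ + ρ / 2 * ‖x - s.fst i‖ ^ 2)
      {x | P.H i x = 0} (y i)

/-- The objective of the coupled quadratic program at `y`,
`∑ i, ‖B i Δ i‖ ^ 2 + 2 (Δ i)ᵀ (B i)ᵀ b i` with `b i = 𝓕 i (y i)` and `B i` the Jacobian of `𝓕 i`
at `y i`. -/
def qpObjective (S : P.Weights) (M : P.Measurements) (y D : P.States) : ℝ :=
  ∑ i, (‖fderiv ℝ (P.F S M i) (y i) (D i)‖ ^ 2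
    + 2 * ⟪fderiv ℝ (P.F S M i) (y i) (D i), P.F S M i (y i)⟫)

/-- The constraints of the coupled quadratic program at `y`: `∑ i, A i (y i + Δ i) = 0` and
`C i Δ i = 0`, with `C i` the Jacobian of `𝓗 i` at `y i`. -/
def qpFeasible (y : P.States) : Set P.States :=
  {D | ∑ i, P.applyA i (y i + D i) = 0 ∧ ∀ i, fderiv ℝ (P.H i) (y i) (D i) = 0}

/-- `D` is a minimizer of the coupled quadratic program at `y` and `lam` is a Lagrange multiplier
of its consensus constraint (together with some multipliers `kap` of `C i Δ i = 0`). -/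
def IsQPSolution (S : P.Weights) (M : P.Measurements) (y D : P.States)
    (lam : P.ConsMult) : Prop :=
  D ∈ P.qpFeasible y ∧ IsMinOn (P.qpObjective S M y) (P.qpFeasible y) D ∧
    ∃ kap : P.FlowMult, ∀ (i : Fin R) (d : GridState (P.RegBus i)),
      2 * ⟪fderiv ℝ (P.F S M i) (y i) (D i), fderiv ℝ (P.F S M i) (y i) d⟫
        + 2 * ⟪P.F S M i (y i), fderiv ℝ (P.F S M i) (y i) d⟫
        + ⟪lam, P.applyA i d⟫ + ⟪kap i, fderiv ℝ (P.H i) (y i) d⟫ = 0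

/-- The consensus step: `t = (y + Δ, lam)` for a solution `Δ` of the coupled quadratic program at
`y` with multiplier `lam`. -/
def ConsensusStep (S : P.Weights) (M : P.Measurements) (y : P.States) (t : P.Iterate) : Prop :=
  ∃ D, t.fst = y + D ∧ P.IsQPSolution S M y D t.snd

/-- One step of Gauss-Newton ALADIN from the iterate `s` to the iterate `t`, where the solution
`y` of the parallelizable step is taken from the set `U`. The termination test of the algorithm,
which only cuts the sequence of iterates, is left out. -/
def AladinStep (S : P.Weights) (M : P.Measurements) (ρ : ℝ) (U : Set P.States)
    (s t : P.Iterate) : Prop :=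
  ∃ y ∈ U, P.ParallelStep S M ρ s y ∧ P.ConsensusStep S M y t

end PartitionedGrid

end

open Filter Topology
open scoped Matrix MatrixOrder RealInnerProductSpace

noncomputable section

/-! All regions together form one problem: minimize `‖F x - c‖ ^ 2` subject to `A x = 0` and `H x =
0`. The measured values enter only through the shift `c`, so every constant describing `F`, `H`, `A`
near the solution is fixed before the data are known; this is why the threshold depends on nothing
else.

Two structural facts carry the argument. The derivative of `F` is injective, because its bus part is
the block matrix of the invertible roots of the `Σ_k`. The pair of `A` and the derivative of `H` is
surjective, because the net powers occur in the power-flow equations with coefficient one and do not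
occur in `A`. Surjectivity bounds multipliers by the functional they represent
(`exists_multiplier_bound`), so at a stationary point of small residual the multipliers are small
too. The second-order terms weighted by residual and multipliers are then dominated by `‖F' d‖ ^ 2`,
and the Lagrangian grows quadratically in all directions, not just in tangential ones
(`RegularBounds.growth`).

Growth gives existence and uniqueness of the nearby subproblem solution `y`, and an error of `y` at
most `σ` times the error of the iterate, with `σ` independent of `ρ`. The Gauss-Newton step neglects
only terms weighted by residual and multipliers, besides quadratic remainders. If `ε` bounds the
residual, the power-flow multiplier and the distance of `y`, the new errors of both state and
consensus multiplier are of order `ε` times the error of `y` (`RegularBounds.kkt_error`). A small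
`ε` yields the contraction factor `1 / 2`; the parameter `ρ` influences only the radii
(`RegularBounds.exists_threshold`). -/

/-! ### Uniform Taylor bounds for twice continuously differentiable maps. -/

/-- Uniform first- and second-order bounds, with one constant `K`, for a map with Lipschitz
derivative on the ball of radius `r` about `x₀`. -/
structure HasTaylorBounds {E G : Type*} [NormedAddCommGroup E] [NormedSpace ℝ E]
    [NormedAddCommGroup G] [NormedSpace ℝ G] (f : E → G) (x₀ : E) (r K : ℝ) : Prop where
  strict : ∀ x ∈ Metric.ball x₀ r, HasStrictFDerivAt f (fderiv ℝ f x) x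
  norm_fderiv : ∀ x ∈ Metric.ball x₀ r, ‖fderiv ℝ f x‖ ≤ K
  fderiv_sub : ∀ x ∈ Metric.ball x₀ r, ∀ y ∈ Metric.ball x₀ r,
    ‖fderiv ℝ f y - fderiv ℝ f x‖ ≤ K * ‖y - x‖
  sub : ∀ x ∈ Metric.ball x₀ r, ∀ y ∈ Metric.ball x₀ r, ‖f y - f x‖ ≤ K * ‖y - x‖
  taylor : ∀ x ∈ Metric.ball x₀ r, ∀ y ∈ Metric.ball x₀ r,
    ‖f y - f x - fderiv ℝ f x (y - x)‖ ≤ K * ‖y - x‖ ^ 2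

section Taylor

variable {E G : Type*} [NormedAddCommGroup E] [NormedSpace ℝ E]
    [NormedAddCommGroup G] [NormedSpace ℝ G] {f : E → G} {x₀ : E}

theorem HasTaylorBounds.mono {r K r' K' : ℝ} (h : HasTaylorBounds f x₀ r K) (hr : r' ≤ r)
    (hK : K ≤ K') : HasTaylorBounds f x₀ r' K' := by
  have hb : Metric.ball x₀ r' ⊆ Metric.ball x₀ r := Metric.ball_subset_ball hr
  refine ⟨fun x hx => h.strict x (hb hx), fun x hx => (h.norm_fderiv x (hb hx)).trans hK,
    fun x hx y hy => (h.fderiv_sub x (hb hx) y (hb hy)).trans ?_,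
    fun x hx y hy => (h.sub x (hb hx) y (hb hy)).trans ?_,
    fun x hx y hy => (h.taylor x (hb hx) y (hb hy)).trans ?_⟩ <;> gcongr

theorem ContDiffAt.exists_hasTaylorBounds (hf : ContDiffAt ℝ 2 f x₀) :
    ∃ r K : ℝ, 0 < r ∧ 0 ≤ K ∧ HasTaylorBounds f x₀ r K := by
  obtain ⟨L, t, ht, hL⟩ := (hf.fderiv_right (m := 1) (by norm_num)).exists_lipschitzOnWith
  have hev : ∀ᶠ x in 𝓝 x₀, ContDiffAt ℝ 2 f x := hf.eventually (by simp)
  obtain ⟨r, hr, hball⟩ := Metric.eventually_nhds_iff_ball.1 (hev.and ht)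
  have hdiff : ∀ x ∈ Metric.ball x₀ r, DifferentiableAt ℝ f x := fun x hx =>
    (hball x hx).1.differentiableAt (by norm_num)
  have hlip : ∀ x ∈ Metric.ball x₀ r, ∀ y ∈ Metric.ball x₀ r,
      ‖fderiv ℝ f y - fderiv ℝ f x‖ ≤ L * ‖y - x‖ := fun x hx y hy => by
    simpa [dist_eq_norm] using hL.dist_le_mul y (hball y hy).2 x (hball x hx).2
  have hx₀ : x₀ ∈ Metric.ball x₀ r := Metric.mem_ball_self hr
  have hbd : ∀ x ∈ Metric.ball x₀ r, ‖fderiv ℝ f x‖ ≤ L * r + ‖fderiv ℝ f x₀‖ := fun x hx => by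
    have h1 := hlip x₀ hx₀ x hx
    have h2 : ‖x - x₀‖ ≤ r := by rw [← dist_eq_norm]; exact (Metric.mem_ball.1 hx).le
    have h3 := norm_le_norm_add_norm_sub (fderiv ℝ f x₀) (fderiv ℝ f x)
    rw [norm_sub_rev] at h3
    nlinarith [mul_le_mul_of_nonneg_left h2 L.2]
  have hLK : (L : ℝ) ≤ L + (L * r + ‖fderiv ℝ f x₀‖) := by
    have := mul_nonneg L.2 hr.le
    have := norm_nonneg (fderiv ℝ f x₀)
    linarith!
  have hLK' : L * r + ‖fderiv ℝ f x₀‖ ≤ L + (L * r + ‖fderiv ℝ f x₀‖) := by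
    have := L.2
    linarith!
  refine ⟨r, L + (L * r + ‖fderiv ℝ f x₀‖), hr, L.2.trans hLK, ?_, ?_, ?_, ?_, ?_⟩
  · exact fun x hx => (hball x hx).1.hasStrictFDerivAt (by norm_num)
  · exact fun x hx => (hbd x hx).trans hLK'
  · exact fun x hx y hy => (hlip x hx y hy).trans (by gcongr)
  · intro x hx y hy
    exact (convex_ball x₀ r).norm_image_sub_le_of_norm_fderiv_le hdiff
      (fun z hz => (hbd z hz).trans hLK') hx hy
  · intro x hx y hy
    -- Intersecting with the closed ball of radius `‖y - x‖` about `x` limits the variation of the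
    -- derivative to `L * ‖y - x‖`, which makes the mean value remainder quadratic.
    have hconv : Convex ℝ (Metric.ball x₀ r ∩ Metric.closedBall x ‖y - x‖) :=
      (convex_ball x₀ r).inter (convex_closedBall x _)
    have := hconv.norm_image_sub_le_of_norm_fderiv_le' (x := x) (y := y) (φ := fderiv ℝ f x)
      (C := L * ‖y - x‖) (fun z hz => hdiff z hz.1) (fun z hz => (hlip x hx z hz.1).trans (by
        have := hz.2
        rw [Metric.mem_closedBall, dist_eq_norm] at this
        gcongr)) ⟨hx, by simp⟩ ⟨hy, by simp [dist_eq_norm]⟩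
    calc _ ≤ _ := this
      _ = L * ‖y - x‖ ^ 2 := by ring
      _ ≤ _ := by gcongr

end Taylor

/-! ### Regularity constants and quadratic growth of the Lagrangian. -/

/-- Uniform constants near a point for the equality constrained least-squares problem
`min ‖F x - c‖ ^ 2` subject to `A x = 0` and `H x = 0`: Taylor bounds, a lower bound for the
derivative of `F`, and a bound for multipliers in terms of the functional they represent. -/
structure RegularBounds {X Y Z W : Type*} [NormedAddCommGroup X] [InnerProductSpace ℝ X]
    [NormedAddCommGroup Y] [InnerProductSpace ℝ Y] [NormedAddCommGroup Z] [InnerProductSpace ℝ Z]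
    [NormedAddCommGroup W] [InnerProductSpace ℝ W]
    (F : X → Y) (H : X → Z) (A : X →L[ℝ] W) (x₀ : X) (r μ K : ℝ) : Prop where
  r_pos : 0 < r
  μ_pos : 0 < μ
  one_le_K : 1 ≤ K
  tF : HasTaylorBounds F x₀ r K
  tH : HasTaylorBounds H x₀ r K
  norm_A : ‖A‖ ≤ K
  lower_fderiv : ∀ x ∈ Metric.ball x₀ r, ∀ d, μ * ‖d‖ ≤ ‖fderiv ℝ F x d‖
  lower_sub : ∀ x ∈ Metric.ball x₀ r, ∀ y ∈ Metric.ball x₀ r, μ * ‖y - x‖ ≤ ‖F y - F x‖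
  dual : ∀ x ∈ Metric.ball x₀ r, ∀ (w : W) (k : Z) (B : ℝ), 0 ≤ B →
    (∀ d, |⟪w, A d⟫ + ⟪k, fderiv ℝ H x d⟫| ≤ B * ‖d‖) → ‖w‖ ≤ K * B ∧ ‖k‖ ≤ K * B
section Regular

variable {X Y Z W : Type*} [NormedAddCommGroup X] [InnerProductSpace ℝ X]
    [NormedAddCommGroup Y] [InnerProductSpace ℝ Y] [NormedAddCommGroup Z] [InnerProductSpace ℝ Z]
    [NormedAddCommGroup W] [InnerProductSpace ℝ W]
    {F : X → Y} {H : X → Z} {A : X →L[ℝ] W} {x₀ : X}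

theorem abs_inner_apply_le {V U : Type*} [NormedAddCommGroup V] [InnerProductSpace ℝ V]
    [NormedAddCommGroup U] [InnerProductSpace ℝ U] (v : V) (T : U →L[ℝ] V) (d : U) {b K : ℝ}
    (hv : ‖v‖ ≤ b) (hT : ‖T‖ ≤ K) : |⟪v, T d⟫| ≤ b * K * ‖d‖ := by
  calc |⟪v, T d⟫| ≤ ‖v‖ * ‖T d‖ := abs_real_inner_le_norm _ _
    _ ≤ b * (K * ‖d‖) := by
        have := T.le_of_opNorm_le hT d
        have := norm_nonneg v
        gcongr
        linarith
    _ = _ := by ring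

/-- A right inverse `T` of `(A, C)` supplies the test vector `d = T (w, k)`, on which the functional
is `‖w‖ ^ 2 + ‖k‖ ^ 2` up to the perturbation `C' - C`. The choice of `ε` makes that perturbation at
most a quarter of the squared norm, so it can be absorbed. -/
theorem exists_multiplier_bound [FiniteDimensional ℝ Z] [FiniteDimensional ℝ W]
    (C : X →L[ℝ] Z) (hs : Function.Surjective fun d => (A d, C d)) :
    ∃ K ε : ℝ, 0 ≤ K ∧ 0 < ε ∧ ∀ C' : X →L[ℝ] Z, ‖C' - C‖ ≤ ε → ∀ (w : W) (k : Z) (B : ℝ), 0 ≤ B →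
      (∀ d, |⟪w, A d⟫ + ⟪k, C' d⟫| ≤ B * ‖d‖) → ‖w‖ ≤ K * B ∧ ‖k‖ ≤ K * B := by
  obtain ⟨g, hg⟩ := LinearMap.exists_rightInverse_of_surjective
    ((A.prod C : X →L[ℝ] W × Z) : X →ₗ[ℝ] W × Z) (LinearMap.range_eq_top.2 hs)
  set T : W × Z →L[ℝ] X := LinearMap.toContinuousLinearMap g with hT
  have hTA : ∀ p, A (T p) = p.1 := fun p => congrArg Prod.fst (LinearMap.congr_fun hg p)
  have hTC : ∀ p, C (T p) = p.2 := fun p => congrArg Prod.snd (LinearMap.congr_fun hg p)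
  have hT0 := norm_nonneg T
  refine ⟨2 * ‖T‖, 1 / (4 * (‖T‖ + 1)), by positivity, by positivity, ?_⟩
  intro C' hC' w k B hB0 hB
  set p : W × Z := (w, k) with hp
  have hwp : ‖w‖ ≤ ‖p‖ := norm_fst_le p
  have hkp : ‖k‖ ≤ ‖p‖ := norm_snd_le p
  have h1 := (le_abs_self _).trans (hB (T p))
  have h2 : |⟪k, (C' - C) (T p)⟫| ≤ ‖k‖ * (1 / (4 * (‖T‖ + 1))) * ‖T p‖ :=
    abs_inner_apply_le k (C' - C) (T p) le_rfl hC'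
  have h3 : C' (T p) = p.2 + (C' - C) (T p) := by simp [hTC]
  rw [hTA, h3, inner_add_right] at h1
  have h4 : ‖T p‖ ≤ ‖T‖ * ‖p‖ := T.le_opNorm p
  have h5 : ‖k‖ * (1 / (4 * (‖T‖ + 1))) * ‖T p‖ ≤ ‖p‖ * ‖p‖ / 4 := by
    have : ‖T‖ / (‖T‖ + 1) ≤ 1 := by rw [div_le_one (by positivity)]; linarith
    calc _ ≤ ‖p‖ * (1 / (4 * (‖T‖ + 1))) * (‖T‖ * ‖p‖) := by gcongr
      _ = ‖p‖ * ‖p‖ / 4 * (‖T‖ / (‖T‖ + 1)) := by field_simp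
      _ ≤ ‖p‖ * ‖p‖ / 4 * 1 := by gcongr
      _ = _ := by ring
  have h6 : B * ‖T p‖ ≤ B * ‖T‖ * ‖p‖ :=
    (mul_le_mul_of_nonneg_left h4 hB0).trans_eq (by ring)
  have h7 := neg_abs_le ⟪k, (C' - C) (T p)⟫
  simp only [hp, real_inner_self_eq_norm_sq] at h1
  have h8 : ‖p‖ ^ 2 ≤ ‖w‖ ^ 2 + ‖k‖ ^ 2 := by
    rw [Prod.norm_def]
    rcases max_cases ‖p.1‖ ‖p.2‖ with h | h <;> rw [h.1] <;> simp only [hp] <;> nlinarith [sq_nonneg ‖w‖, sq_nonneg ‖k‖]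
  have h9 : ‖p‖ * ‖p‖ ≤ 2 * ‖T‖ * B * ‖p‖ := by
    have : 0 ≤ B * ‖T‖ * ‖p‖ := by positivity
    simp only [hp] at *
    nlinarith
  have h10 : ‖p‖ ≤ 2 * ‖T‖ * B := by
    rcases (norm_nonneg p).eq_or_lt with h | h
    · rw [← h]; positivity
    · exact le_of_mul_le_mul_right h9 h
  exact ⟨hwp.trans h10, hkp.trans h10⟩

/-- Injectivity and surjectivity at the single point `x₀` are open conditions, and the Lipschitz
bounds on the derivatives make them uniform on a small ball. -/
theorem exists_regularBounds [FiniteDimensional ℝ X] [FiniteDimensional ℝ Z]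
    [FiniteDimensional ℝ W] (hF : ContDiffAt ℝ 2 F x₀) (hH : ContDiffAt ℝ 2 H x₀)
    (hinj : Function.Injective (fderiv ℝ F x₀))
    (hsurj : Function.Surjective fun d => (A d, fderiv ℝ H x₀ d)) :
    ∃ r μ K : ℝ, RegularBounds F H A x₀ r μ K := by
  obtain ⟨r₁, K₁, hr₁, hK₁, hF⟩ := hF.exists_hasTaylorBounds
  obtain ⟨r₂, K₂, hr₂, hK₂, hH⟩ := hH.exists_hasTaylorBounds
  obtain ⟨K₃, ε, hK₃, hε, hdual⟩ := exists_multiplier_bound (A := A) _ hsurj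
  obtain ⟨ν, hν, hanti⟩ := LinearMap.exists_antilipschitzWith
    (fderiv ℝ F x₀ : X →ₗ[ℝ] Y) (LinearMap.ker_eq_bot.2 hinj)
  replace hanti : ∀ d, ‖d‖ ≤ ν * ‖fderiv ℝ F x₀ d‖ := fun d => by
    simpa using hanti.le_mul_dist d 0
  have hν' : (0 : ℝ) < ν := hν
  set K := K₁ + K₂ + K₃ + ‖A‖ + 1 with hK
  have hA := norm_nonneg A
  have hK1 : 1 ≤ K := by linarith
  have hK0 : 0 < K := by linarith
  -- The lower bound is `4 * μ` at `x₀`. Moving the base point within the ball costs `μ`, and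
  -- passing from derivatives to differences costs another `2 * μ`, which leaves `μ`.
  set μ : ℝ := 1 / (4 * ν) with hμ
  have hμ0 : 0 < μ := by positivity
  set r := min (min r₁ r₂) (min (ε / K) (μ / K)) with hr
  have hr0 : 0 < r := by positivity
  have hr1 : r ≤ r₁ := (min_le_left _ _).trans (min_le_left _ _)
  have hr2 : r ≤ r₂ := (min_le_left _ _).trans (min_le_right _ _)
  have hr3 : K * r ≤ ε := by
    have : r ≤ ε / K := (min_le_right _ _).trans (min_le_left _ _)
    rw [le_div_iff₀ hK0] at this
    linarith
  have hr4 : K * r ≤ μ := by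
    have : r ≤ μ / K := (min_le_right _ _).trans (min_le_right _ _)
    rw [le_div_iff₀ hK0] at this
    linarith
  have hx₀ : x₀ ∈ Metric.ball x₀ r := Metric.mem_ball_self hr0
  replace hF := hF.mono hr1 (show K₁ ≤ K by linarith)
  replace hH := hH.mono hr2 (show K₂ ≤ K by linarith)
  have hlow : ∀ x ∈ Metric.ball x₀ r, ∀ d, 3 * μ * ‖d‖ ≤ ‖fderiv ℝ F x d‖ := by
    intro x hx d
    have h1 : ‖x - x₀‖ ≤ r := (mem_ball_iff_norm.1 hx).le
    have h2 : ‖(fderiv ℝ F x - fderiv ℝ F x₀) d‖ ≤ μ * ‖d‖ :=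
      ContinuousLinearMap.le_of_opNorm_le _
        ((hF.fderiv_sub x₀ hx₀ x hx).trans ((by gcongr : K * ‖x - x₀‖ ≤ K * r).trans hr4)) d
    have h3 : 4 * μ * ‖d‖ ≤ ‖fderiv ℝ F x₀ d‖ := by
      have := hanti d
      rw [hμ]
      field_simp
      linarith
    have h4 : ‖fderiv ℝ F x₀ d‖ ≤ ‖fderiv ℝ F x d‖ + ‖(fderiv ℝ F x - fderiv ℝ F x₀) d‖ := by
      have := norm_sub_le (fderiv ℝ F x d) ((fderiv ℝ F x - fderiv ℝ F x₀) d)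
      simpa using this
    linarith
  refine ⟨r, μ, K, hr0, hμ0, hK1, hF, hH, by linarith, fun x hx d => ?_, fun x hx y hy => ?_, ?_⟩
  · have := hlow x hx d
    have : 0 ≤ μ * ‖d‖ := by positivity
    linarith
  · have h1 := hlow x hx (y - x)
    have h2 := hF.taylor x hx y hy
    have h3 : ‖y - x‖ ≤ 2 * r := by
      have h1 := mem_ball_iff_norm.1 hx
      have h2 := mem_ball_iff_norm.1 hy
      have := norm_sub_le (y - x₀) (x - x₀)
      rw [sub_sub_sub_cancel_right] at this
      linarith
    have h4 : K * ‖y - x‖ ^ 2 ≤ 2 * μ * ‖y - x‖ := by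
      calc _ = K * ‖y - x‖ * ‖y - x‖ := by ring
        _ ≤ K * (2 * r) * ‖y - x‖ := by gcongr
        _ = 2 * (K * r) * ‖y - x‖ := by ring
        _ ≤ _ := by gcongr
    have h5 := norm_sub_norm_le (fderiv ℝ F x (y - x)) (F y - F x)
    rw [norm_sub_rev (fderiv ℝ F x (y - x))] at h5
    linarith
  · intro x hx w k B hB hd
    have h1 : ‖x - x₀‖ ≤ r := (mem_ball_iff_norm.1 hx).le
    have h2 := hdual (fderiv ℝ H x)
      ((hH.fderiv_sub x₀ hx₀ x hx).trans ((by gcongr : K * ‖x - x₀‖ ≤ K * r).trans hr3)) w k B hB hd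
    have h3 : K₃ * B ≤ K * B := mul_le_mul_of_nonneg_right (by linarith) hB
    exact ⟨h2.1.trans h3, h2.2.trans h3⟩

namespace RegularBounds

variable {r μ K : ℝ}

/-- Quadratic growth of the Lagrangian of a small-residual least-squares problem. -/
theorem growth (h : RegularBounds F H A x₀ r μ K) {x y : X} (hx : x ∈ Metric.ball x₀ r) (hy : y ∈ Metric.ball x₀ r) {c : Y} {k : Z}
    {ε : ℝ} (hε : 6 * K * ε ≤ μ ^ 2) (hb : ‖F x - c‖ ≤ ε) (hk : ‖k‖ ≤ ε) :
    ‖F x - c‖ ^ 2 + 2 * ⟪F x - c, fderiv ℝ F x (y - x)⟫ + ⟪k, fderiv ℝ H x (y - x)⟫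
      + μ ^ 2 / 2 * ‖y - x‖ ^ 2 ≤ ‖F y - c‖ ^ 2 + ⟪k, H y - H x⟫ := by
  have hK := h.one_le_K
  set RF := F y - F x - fderiv ℝ F x (y - x) with hRF
  set RH := H y - H x - fderiv ℝ H x (y - x) with hRH
  have e1 : F y - c = (F x - c) + (F y - F x) := by abel
  have e2 : F y - F x = fderiv ℝ F x (y - x) + RF := by rw [hRF]; abel
  have e3 : H y - H x = fderiv ℝ H x (y - x) + RH := by rw [hRH]; abel
  have h0 : ‖F y - c‖ ^ 2 = ‖F x - c‖ ^ 2 + 2 * ⟪F x - c, fderiv ℝ F x (y - x)⟫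
      + 2 * ⟪F x - c, RF⟫ + ‖F y - F x‖ ^ 2 := by
    rw [e1, norm_add_sq_real]
    conv_lhs => rw [show ⟪F x - c, F y - F x⟫
      = ⟪F x - c, fderiv ℝ F x (y - x)⟫ + ⟪F x - c, RF⟫ by rw [e2, inner_add_right]]
    ring
  have h1 : |⟪F x - c, RF⟫| ≤ ε * (K * ‖y - x‖ ^ 2) :=
    (abs_real_inner_le_norm _ _).trans (mul_le_mul hb (h.tF.taylor x hx y hy)
      (norm_nonneg _) ((norm_nonneg _).trans hb))
  have h2 : |⟪k, RH⟫| ≤ ε * (K * ‖y - x‖ ^ 2) :=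
    (abs_real_inner_le_norm _ _).trans (mul_le_mul hk (h.tH.taylor x hx y hy)
      (norm_nonneg _) ((norm_nonneg _).trans hb))
  have h3 : μ ^ 2 * ‖y - x‖ ^ 2 ≤ ‖F y - F x‖ ^ 2 := by
    rw [← mul_pow]
    exact pow_le_pow_left₀ (mul_nonneg h.μ_pos.le (norm_nonneg _)) (h.lower_sub x hx y hy) 2
  have h4 : 3 * (ε * (K * ‖y - x‖ ^ 2)) ≤ μ ^ 2 / 2 * ‖y - x‖ ^ 2 := by
    have := mul_le_mul_of_nonneg_right hε (sq_nonneg ‖y - x‖)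
    linarith
  have h5 := neg_abs_le ⟪F x - c, RF⟫
  have h6 := neg_abs_le ⟪k, RH⟫
  rw [h0, e3, inner_add_right]
  linarith

end RegularBounds

end Regular

/-! ### The decoupled subproblem, the coupled quadratic program and the error of one step. -/

namespace RegularBounds

variable {X Y Z W : Type*} [NormedAddCommGroup X] [InnerProductSpace ℝ X]
    [NormedAddCommGroup Y] [InnerProductSpace ℝ Y] [NormedAddCommGroup Z] [InnerProductSpace ℝ Z]
    [NormedAddCommGroup W] [InnerProductSpace ℝ W]
    {F : X → Y} {H : X → Z} {A : X →L[ℝ] W} {x₀ : X} {r μ K : ℝ}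

/-- Lagrange multipliers of the decoupled subproblem. -/
theorem exists_multiplier [CompleteSpace X] [FiniteDimensional ℝ Z]
    (h : RegularBounds F H A x₀ r μ K) {c : Y} {w : W} {ρ : ℝ} {y z : X}
    (hy : y ∈ Metric.ball x₀ r) (hHy : H y = 0)
    (hmin : IsLocalMinOn (fun x => ‖F x - c‖ ^ 2 + ⟪w, A x⟫ + ρ / 2 * ‖x - z‖ ^ 2)
      {x | H x = 0} y) :
    ∃ k : Z, ∀ d, 2 * ⟪F y - c, fderiv ℝ F y d⟫ + ⟪w, A d⟫ + ρ * ⟪y - z, d⟫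
      + ⟪k, fderiv ℝ H y d⟫ = 0 := by
  have : CompleteSpace Z := FiniteDimensional.complete ℝ Z
  have hf1 := (hasStrictFDerivAt_norm_sq (F y - c)).comp y ((h.tF.strict y hy).sub_const c)
  have hf2 := (innerSL ℝ w).hasStrictFDerivAt.comp y A.hasStrictFDerivAt
  have hf3 := ((hasStrictFDerivAt_norm_sq (y - z)).comp y
    ((hasStrictFDerivAt_id y).sub_const z)).const_mul (ρ / 2)
  have hloc : IsLocalExtrOn (fun x => ‖F x - c‖ ^ 2 + ⟪w, A x⟫ + ρ / 2 * ‖x - z‖ ^ 2)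
      {x | H x = H y} y := by
    rw [hHy]
    exact Or.inl hmin
  obtain ⟨Λ, a, hne, hΛ⟩ := hloc.exists_linear_map_of_hasStrictFDerivAt (h.tH.strict y hy)
    ((hf1.add hf2).add hf3)
  have key : ∀ d, Λ (fderiv ℝ H y d) + a * (2 * ⟪F y - c, fderiv ℝ F y d⟫ + ⟪w, A d⟫
      + ρ * ⟪y - z, d⟫) = 0 := by
    intro d
    have := hΛ d
    simp only [_root_.add_apply, ContinuousLinearMap.comp_apply,
      _root_.smul_apply, innerSL_apply_apply, smul_eq_mul, nsmul_eq_mul,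
      ContinuousLinearMap.id_apply] at this
    push_cast at this
    linarith
  set k := (InnerProductSpace.toDual ℝ Z).symm (LinearMap.toContinuousLinearMap Λ) with hk
  have hkΛ : ∀ v, ⟪k, v⟫ = Λ v := fun v => by
    rw [hk, InnerProductSpace.toDual_symm_apply]
    rfl
  -- If the objective had coefficient zero, the constraint functional alone would vanish on all
  -- directions, and the multiplier bound with `B = 0` would force `Λ = 0` as well.
  have ha : a ≠ 0 := by
    rintro rfl
    have hk0 := (h.dual y hy 0 k 0 le_rfl fun d => by
      have := key d
      rw [hkΛ, inner_zero_left]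
      simpa using this).2
    rw [mul_zero, norm_le_zero_iff] at hk0
    refine hne (Prod.ext (LinearMap.ext fun v => ?_) rfl)
    rw [← hkΛ, hk0, inner_zero_left]
    rfl
  refine ⟨a⁻¹ • k, fun d => ?_⟩
  rw [real_inner_smul_left, hkΛ, eq_neg_of_add_eq_zero_left (key d)]
  field_simp
  ring

/-- Every local solution of a decoupled subproblem with small residual, multiplier and
displacement is a strict minimizer on the feasible points of the ball. -/
theorem subproblem_growth [CompleteSpace X] [FiniteDimensional ℝ Z]
    (h : RegularBounds F H A x₀ r μ K) {c : Y} {w : W} {ρ ε B : ℝ} {x y z : X}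
    (hε : 6 * K * ε ≤ μ ^ 2) (hρ : 0 ≤ ρ)
    (hx : x ∈ Metric.ball x₀ r) (hHx : H x = 0) (hy : y ∈ Metric.ball x₀ r) (hHy : H y = 0)
    (hB : 2 * ‖F y - c‖ * K + ‖w‖ * K + ρ * ‖y - z‖ ≤ B) (hBε : K * B ≤ ε)
    (hmin : IsLocalMinOn (fun x => ‖F x - c‖ ^ 2 + ⟪w, A x⟫ + ρ / 2 * ‖x - z‖ ^ 2)
      {x | H x = 0} y) :
    (‖F y - c‖ ^ 2 + ⟪w, A y⟫ + ρ / 2 * ‖y - z‖ ^ 2) + (μ ^ 2 + ρ) / 2 * ‖x - y‖ ^ 2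
      ≤ ‖F x - c‖ ^ 2 + ⟪w, A x⟫ + ρ / 2 * ‖x - z‖ ^ 2 := by
  have hK := h.one_le_K
  have hb0 := norm_nonneg (F y - c)
  have hw0 := mul_nonneg (norm_nonneg w) (zero_le_one.trans hK)
  have hz0 := mul_nonneg hρ (norm_nonneg (y - z))
  have hbK := mul_le_mul_of_nonneg_left hK hb0
  have hB0 : 0 ≤ B := by linarith
  have hBB : B ≤ ε := by nlinarith
  obtain ⟨k, hk⟩ := h.exists_multiplier hy hHy hmin
  have hkε : ‖k‖ ≤ ε := by
    -- By stationarity `k` represents minus the gradient of the subproblem objective, whose norm is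
    -- at most `B`.
    refine ((h.dual y hy 0 k B hB0 fun d => ?_).2).trans hBε
    have h1 := abs_inner_apply_le (F y - c) (fderiv ℝ F y) d le_rfl (h.tF.norm_fderiv y hy)
    have h2 := abs_inner_apply_le w A d le_rfl h.norm_A
    have h3 := abs_real_inner_le_norm (y - z) d
    have h4 : ⟪(0 : W), A d⟫ + ⟪k, fderiv ℝ H y d⟫
        = -(2 * ⟪F y - c, fderiv ℝ F y d⟫ + ⟪w, A d⟫ + ρ * ⟪y - z, d⟫) := by
      rw [inner_zero_left]
      linarith [hk d]
    rw [h4, abs_neg]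
    calc _ ≤ |2 * ⟪F y - c, fderiv ℝ F y d⟫| + |⟪w, A d⟫| + |ρ * ⟪y - z, d⟫| := abs_add_three _ _ _
      _ ≤ 2 * (‖F y - c‖ * K * ‖d‖) + ‖w‖ * K * ‖d‖ + ρ * (‖y - z‖ * ‖d‖) := by
          rw [abs_mul, abs_mul, abs_of_nonneg hρ, abs_of_pos (two_pos : (0 : ℝ) < 2)]
          gcongr
      _ = (2 * ‖F y - c‖ * K + ‖w‖ * K + ρ * ‖y - z‖) * ‖d‖ := by ring
      _ ≤ B * ‖d‖ := by gcongr
  have hg := h.growth hy hx hε (c := c) (by linarith) hkε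
  have e1 : ‖x - z‖ ^ 2 = ‖y - z‖ ^ 2 + 2 * ⟪y - z, x - y⟫ + ‖x - y‖ ^ 2 := by
    rw [← norm_add_sq_real, add_comm, sub_add_sub_cancel]
  have e2 : ⟪w, A x⟫ = ⟪w, A y⟫ + ⟪w, A (x - y)⟫ := by
    rw [← inner_add_right, ← map_add, add_sub_cancel]
  have hk' := hk (x - y)
  rw [hHx, hHy, sub_zero, inner_zero_right] at hg
  rw [e1, e2]
  linarith

/-- A minimizer over the compact feasible part of the closed ball exists. Comparing its value with
that at `x₀`, by growth and stationarity there, gives the error bound; this places it strictly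
inside the ball, so it is a local minimizer among all feasible points. -/
theorem exists_subproblem_solution [FiniteDimensional ℝ X]
    (h : RegularBounds F H A x₀ r μ K) {c : Y} {ws w : W} {ks : Z} {ρ ε r' : ℝ} {z : X}
    (hε : 6 * K * ε ≤ μ ^ 2) (hρ : 0 ≤ ρ) (hH : H x₀ = 0) (hb : ‖F x₀ - c‖ ≤ ε) (hks : ‖ks‖ ≤ ε)
    (hst : ∀ d, 2 * ⟪F x₀ - c, fderiv ℝ F x₀ d⟫ + ⟪ws, A d⟫ + ⟪ks, fderiv ℝ H x₀ d⟫ = 0)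
    (hr' : r' < r) (hr'0 : 0 < r')
    (hs : 2 * (K * ‖w - ws‖ + ρ * ‖z - x₀‖) < (μ ^ 2 + ρ) * r') :
    ∃ y, H y = 0 ∧ IsLocalMinOn (fun x => ‖F x - c‖ ^ 2 + ⟪w, A x⟫ + ρ / 2 * ‖x - z‖ ^ 2)
      {x | H x = 0} y ∧ ‖y - x₀‖ < r' ∧
      (μ ^ 2 + ρ) * ‖y - x₀‖ ≤ 2 * (K * ‖w - ws‖ + ρ * ‖z - x₀‖) := by
  set f : X → ℝ := fun x => ‖F x - c‖ ^ 2 + ⟪w, A x⟫ + ρ / 2 * ‖x - z‖ ^ 2 with hf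
  have hsub : Metric.closedBall x₀ r' ⊆ Metric.ball x₀ r := Metric.closedBall_subset_ball hr'
  have hcH : ContinuousOn H (Metric.closedBall x₀ r') := fun x hx =>
    ((h.tH.strict x (hsub hx)).hasFDerivAt.continuousAt).continuousWithinAt
  have hcF : ContinuousOn F (Metric.closedBall x₀ r') := fun x hx =>
    ((h.tF.strict x (hsub hx)).hasFDerivAt.continuousAt).continuousWithinAt
  have hcf : ContinuousOn f (Metric.closedBall x₀ r') := by fun_prop
  have hcpt : IsCompact (Metric.closedBall x₀ r' ∩ H ⁻¹' {0}) :=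
    (isCompact_closedBall x₀ r').of_isClosed_subset
      (hcH.preimage_isClosed_of_isClosed Metric.isClosed_closedBall isClosed_singleton)
      Set.inter_subset_left
  obtain ⟨y, ⟨hyb, hyH⟩, hymin⟩ := hcpt.exists_isMinOn
    ⟨x₀, Metric.mem_closedBall_self hr'0.le, hH⟩ (hcf.mono Set.inter_subset_left)
  replace hyH : H y = 0 := hyH
  have hle : f y ≤ f x₀ := hymin ⟨Metric.mem_closedBall_self hr'0.le, hH⟩
  have hg := h.growth (Metric.mem_ball_self h.r_pos) (hsub hyb) hε hb hks
  have hst' := hst (y - x₀)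
  have e1 : ‖y - z‖ ^ 2 = ‖x₀ - z‖ ^ 2 + 2 * ⟪x₀ - z, y - x₀⟫ + ‖y - x₀‖ ^ 2 := by
    rw [← norm_add_sq_real, add_comm, sub_add_sub_cancel]
  have e2 : ⟪w, A y⟫ = ⟪w, A x₀⟫ + ⟪ws, A (y - x₀)⟫ + ⟪w - ws, A (y - x₀)⟫ := by
    rw [inner_sub_left, add_add_sub_cancel, ← inner_add_right, ← map_add, add_sub_cancel]
  have h1 := abs_inner_apply_le (w - ws) A (y - x₀) le_rfl h.norm_A
  have h2 := abs_real_inner_le_norm (x₀ - z) (y - x₀)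
  rw [norm_sub_rev x₀ z] at h2
  have h1' := neg_abs_le ⟪w - ws, A (y - x₀)⟫
  have h2' := neg_abs_le ⟪x₀ - z, y - x₀⟫
  have h3 : -(ρ * (‖z - x₀‖ * ‖y - x₀‖)) ≤ ρ * ⟪x₀ - z, y - x₀⟫ := by
    rw [← mul_neg]
    gcongr
    linarith
  simp only [hf] at hle
  rw [hyH, hH, sub_zero, inner_zero_right] at hg
  rw [e1, e2] at hle
  have hq : (μ ^ 2 + ρ) * ‖y - x₀‖ * ‖y - x₀‖
      ≤ 2 * (K * ‖w - ws‖ + ρ * ‖z - x₀‖) * ‖y - x₀‖ := by linarith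
  have hbd : (μ ^ 2 + ρ) * ‖y - x₀‖ ≤ 2 * (K * ‖w - ws‖ + ρ * ‖z - x₀‖) := by
    rcases (norm_nonneg (y - x₀)).eq_or_lt with h0 | h0
    · rw [← h0, mul_zero]
      have := h.one_le_K
      positivity
    · exact le_of_mul_le_mul_right hq h0
  have hpos : 0 < μ ^ 2 + ρ := by
    have := pow_pos h.μ_pos 2
    positivity
  have hlt : ‖y - x₀‖ < r' := lt_of_mul_lt_mul_left (hbd.trans_lt hs) hpos.le
  refine ⟨y, hyH, ?_, hlt, hbd⟩
  have hnhds : Metric.closedBall x₀ r' ∈ 𝓝 y :=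
    Filter.mem_of_superset (Metric.isOpen_ball.mem_nhds (mem_ball_iff_norm.2 hlt))
      Metric.ball_subset_closedBall
  filter_upwards [self_mem_nhdsWithin, mem_nhdsWithin_of_mem_nhds hnhds] with x hx hxb
  exact hymin ⟨hxb, hx⟩

/-- The optimality system of the coupled quadratic program is nonsingular. -/
theorem kkt_trivial (h : RegularBounds F H A x₀ r μ K) {y : X} (hy : y ∈ Metric.ball x₀ r)
    {D : X} {w : W} {k : Z}
    (hD : ∀ d, 2 * ⟪fderiv ℝ F y D, fderiv ℝ F y d⟫ + ⟪w, A d⟫ + ⟪k, fderiv ℝ H y d⟫ = 0)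
    (hA : A D = 0) (hC : fderiv ℝ H y D = 0) : D = 0 ∧ w = 0 ∧ k = 0 := by
  have h1 := hD D
  rw [hA, hC, inner_zero_right, inner_zero_right, add_zero, add_zero, mul_eq_zero,
    inner_self_eq_zero] at h1
  have h2 : fderiv ℝ F y D = 0 := h1.resolve_left two_ne_zero
  have h3 := h.lower_fderiv y hy D
  rw [h2, norm_zero] at h3
  have h4 : ‖D‖ ≤ 0 := nonpos_of_mul_nonpos_right h3 h.μ_pos
  have h5 := h.dual y hy w k 0 le_rfl fun d => by
    have := hD d
    rw [h2, inner_zero_left, mul_zero, zero_add] at this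
    rw [this, abs_zero, zero_mul]
  rw [mul_zero, norm_le_zero_iff, norm_le_zero_iff] at h5
  exact ⟨norm_le_zero_iff.1 h4, h5⟩

/-- The optimality system is a square linear system on `X × W × Z`; `kkt_trivial` makes it
injective, hence surjective in finite dimension. -/
theorem exists_kkt [FiniteDimensional ℝ X] [FiniteDimensional ℝ Y] [FiniteDimensional ℝ Z]
    [FiniteDimensional ℝ W] (h : RegularBounds F H A x₀ r μ K) {y : X}
    (hy : y ∈ Metric.ball x₀ r) (b : Y) (a : W) :
    ∃ D w k, (∀ d, 2 * ⟪fderiv ℝ F y D, fderiv ℝ F y d⟫ + 2 * ⟪b, fderiv ℝ F y d⟫ + ⟪w, A d⟫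
      + ⟪k, fderiv ℝ H y d⟫ = 0) ∧ A D = a ∧ fderiv ℝ H y D = 0 := by
  have : CompleteSpace X := FiniteDimensional.complete ℝ X
  have : CompleteSpace Y := FiniteDimensional.complete ℝ Y
  have : CompleteSpace Z := FiniteDimensional.complete ℝ Z
  have : CompleteSpace W := FiniteDimensional.complete ℝ W
  set B := fderiv ℝ F y
  set C := fderiv ℝ H y
  let pX : X × W × Z →L[ℝ] X := ContinuousLinearMap.fst ℝ X (W × Z)
  let pW : X × W × Z →L[ℝ] W :=
    (ContinuousLinearMap.fst ℝ W Z).comp (ContinuousLinearMap.snd ℝ X (W × Z))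
  let pZ : X × W × Z →L[ℝ] Z :=
    (ContinuousLinearMap.snd ℝ W Z).comp (ContinuousLinearMap.snd ℝ X (W × Z))
  let T : X × W × Z →L[ℝ] X × W × Z :=
    ((2 : ℝ) • (B.adjoint.comp (B.comp pX)) + A.adjoint.comp pW + C.adjoint.comp pZ).prod
      ((A.comp pX).prod (C.comp pX))
  have hT : ∀ D w k, T (D, w, k)
      = ((2 : ℝ) • B.adjoint (B D) + A.adjoint w + C.adjoint k, A D, C D) := fun _ _ _ => rfl
  have hinner : ∀ D w k d, ⟪(2 : ℝ) • B.adjoint (B D) + A.adjoint w + C.adjoint k, d⟫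
      = 2 * ⟪B D, B d⟫ + ⟪w, A d⟫ + ⟪k, C d⟫ := fun D w k d => by
    rw [inner_add_left, inner_add_left, real_inner_smul_left,
      ContinuousLinearMap.adjoint_inner_left, ContinuousLinearMap.adjoint_inner_left,
      ContinuousLinearMap.adjoint_inner_left]
  have hinj : Function.Injective (T : X × W × Z →ₗ[ℝ] X × W × Z) := by
    rw [← LinearMap.ker_eq_bot, LinearMap.ker_eq_bot']
    rintro ⟨D, w, k⟩ h0
    replace h0 : T (D, w, k) = 0 := h0
    rw [hT, Prod.mk_eq_zero, Prod.mk_eq_zero] at h0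
    obtain ⟨rfl, rfl, rfl⟩ := h.kkt_trivial hy (D := D) (w := w) (k := k) (fun d => by
      rw [← hinner, h0.1, inner_zero_left]) h0.2.1 h0.2.2
    rfl
  obtain ⟨⟨D, w, k⟩, hD⟩ := LinearMap.injective_iff_surjective.1 hinj
    ((-(2 : ℝ)) • B.adjoint b, a, 0)
  replace hD : T (D, w, k) = _ := hD
  rw [hT, Prod.mk.injEq, Prod.mk.injEq] at hD
  refine ⟨D, w, k, fun d => ?_, hD.2.1, hD.2.2⟩
  have h1 := hinner D w k d
  rw [hD.1, real_inner_smul_left, ContinuousLinearMap.adjoint_inner_left] at h1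
  linarith

/-- One Gauss-Newton step from a feasible point near a solution with residual and multipliers of
size `ε` reduces the error by a factor of order `ε`. -/
theorem kkt_error (h : RegularBounds F H A x₀ r μ K) {c : Y} {ws w : W} {ks k : Z} {ε : ℝ}
    {y D : X} (hy : y ∈ Metric.ball x₀ r) (hHy : H y = 0) (hH : H x₀ = 0) (hA : A x₀ = 0)
    (hb : ‖F x₀ - c‖ ≤ ε) (hks : ‖ks‖ ≤ ε) (hyε : ‖y - x₀‖ ≤ ε)
    (hst : ∀ d, 2 * ⟪F x₀ - c, fderiv ℝ F x₀ d⟫ + ⟪ws, A d⟫ + ⟪ks, fderiv ℝ H x₀ d⟫ = 0)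
    (hD : ∀ d, 2 * ⟪fderiv ℝ F y D, fderiv ℝ F y d⟫ + 2 * ⟪F y - c, fderiv ℝ F y d⟫ + ⟪w, A d⟫
      + ⟪k, fderiv ℝ H y d⟫ = 0) (hAD : A (y + D) = 0) (hCD : fderiv ℝ H y D = 0) :
    ‖y + D - x₀‖ ≤ 7 * K ^ 3 * (7 * K ^ 4 / μ ^ 2 + 1) * (ε * ‖y - x₀‖) ∧
      ‖w - ws‖ ≤ 7 * K ^ 3 * (7 * K ^ 4 / μ ^ 2 + 1) * (ε * ‖y - x₀‖) := by
  have hK := h.one_le_K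
  have hK0 : 0 < K := by linarith
  have hx₀ : x₀ ∈ Metric.ball x₀ r := Metric.mem_ball_self h.r_pos
  have hε : 0 ≤ ε := (norm_nonneg _).trans hb
  set B := fderiv ℝ F y with hBdef
  set C := fderiv ℝ H y with hCdef
  set n := ‖y - x₀‖ with hn
  have hn0 : 0 ≤ n := norm_nonneg _
  set e := y + D - x₀ with he
  set T := F x₀ - F y - B (x₀ - y) with hTdef
  have hrev : ‖x₀ - y‖ = n := norm_sub_rev _ _
  -- Since `‖y - x₀‖ ≤ ε`, quadratic remainders have the same order `ε * n` as the errors weighted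
  -- by residual or multipliers.
  have hnn : n ^ 2 ≤ ε * n := by rw [sq]; gcongr
  have hT : ‖T‖ ≤ K * (ε * n) := by
    refine (h.tF.taylor y hy x₀ hx₀).trans ?_
    rw [hrev]
    gcongr
  -- Both `y` and `x₀` are feasible and `C D = 0`, so `C e` is a pure Taylor remainder.
  have hCe : ‖C e‖ ≤ K * (ε * n) := by
    have h1 : C e = H x₀ - H y - C (x₀ - y) := by
      rw [he, hH, hHy, show y + D - x₀ = D - (x₀ - y) by abel, map_sub, hCD]
      simp
    rw [h1]
    refine (h.tH.taylor y hy x₀ hx₀).trans ?_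
    rw [hrev]
    gcongr
  have hAe : A e = 0 := by rw [he, map_sub, hAD, hA, sub_zero]
  have hBD : B D + (F y - c) = B e + (F x₀ - c) - T := by
    rw [he, hTdef, show y + D - x₀ = D - (x₀ - y) by abel, map_sub]
    abel
  -- Difference of the optimality systems at the new point and at `x₀`: the main term is `2 * ⟪B e,
  -- B d⟫`, everything else is of order `ε * n`.
  have hlin : ∀ d, ⟪w - ws, A d⟫ + ⟪k - ks, C d⟫ = -(2 * ⟪B e, B d⟫
      + (2 * ⟪F x₀ - c, (B - fderiv ℝ F x₀) d⟫ - 2 * ⟪T, B d⟫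
        + ⟪ks, (C - fderiv ℝ H x₀) d⟫)) := by
    intro d
    have h1 := hD d
    have h2 := hst d
    have h3 : ⟪B D, B d⟫ + ⟪F y - c, B d⟫ = ⟪B e, B d⟫ + ⟪F x₀ - c, B d⟫ - ⟪T, B d⟫ := by
      rw [← inner_add_left, hBD, inner_sub_left, inner_add_left]
    simp only [_root_.sub_apply, inner_sub_left, inner_sub_right] at h1 h2 h3 ⊢
    linarith
  have hrem : ∀ d, |2 * ⟪F x₀ - c, (B - fderiv ℝ F x₀) d⟫ - 2 * ⟪T, B d⟫
        + ⟪ks, (C - fderiv ℝ H x₀) d⟫| ≤ 5 * K ^ 2 * (ε * n) * ‖d‖ := by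
    intro d
    have h1 := abs_inner_apply_le (F x₀ - c) (B - fderiv ℝ F x₀) d hb
      (h.tF.fderiv_sub x₀ hx₀ y hy)
    have h2 := abs_inner_apply_le T B d hT (h.tF.norm_fderiv y hy)
    have h3 := abs_inner_apply_le ks (C - fderiv ℝ H x₀) d hks (h.tH.fderiv_sub x₀ hx₀ y hy)
    have h4 : K * (ε * n * ‖d‖) ≤ K ^ 2 * (ε * n * ‖d‖) := by
      gcongr
      nlinarith
    rw [abs_le] at *
    constructor <;> linarith [h1.1, h1.2, h2.1, h2.2, h3.1, h3.2]
  have hBe : ∀ d, |⟪B e, B d⟫| ≤ K ^ 2 * ‖e‖ * ‖d‖ := fun d => by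
    have := abs_inner_apply_le (B e) B d (B.le_of_opNorm_le (h.tF.norm_fderiv y hy) e)
      (h.tF.norm_fderiv y hy)
    linarith
  set t := ε * n with ht
  have ht0 : 0 ≤ t := mul_nonneg hε hn0
  have he0 := norm_nonneg e
  obtain ⟨hw, hk⟩ := h.dual y hy (w - ws) (k - ks) (2 * K ^ 2 * ‖e‖ + 5 * K ^ 2 * t)
    (by positivity) fun d => by
      rw [hlin, abs_neg]
      have h1 := hBe d
      have h2 := hrem d
      rw [abs_le] at *
      constructor <;> linarith [h1.1, h1.2, h2.1, h2.2]
  -- Test with `d = e`. The consensus multiplier drops out because `A e = 0`, and `⟪k - ks, C e⟫` is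
  -- a product of a factor of order `‖e‖ + t` with one of order `t`.
  have hquad : 2 * μ ^ 2 * ‖e‖ ^ 2 ≤ 7 * K ^ 4 * t * (‖e‖ + t) := by
    have h1 := hlin e
    rw [hAe, inner_zero_right, real_inner_self_eq_norm_sq] at h1
    have h2 := hrem e
    have h3 : |⟪k - ks, C e⟫| ≤ K * (2 * K ^ 2 * ‖e‖ + 5 * K ^ 2 * t) * (K * t) :=
      (abs_real_inner_le_norm _ _).trans (mul_le_mul hk hCe (norm_nonneg _) (by positivity))
    have h4 : μ ^ 2 * ‖e‖ ^ 2 ≤ ‖B e‖ ^ 2 := by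
      rw [← mul_pow]
      exact pow_le_pow_left₀ (mul_nonneg h.μ_pos.le he0) (h.lower_fderiv y hy e) 2
    rw [abs_le] at h2 h3
    have h5 : K ^ 2 * (t * ‖e‖) ≤ K ^ 4 * (t * ‖e‖) :=
      mul_le_mul_of_nonneg_right (pow_le_pow_right₀ hK (by norm_num)) (by positivity)
    have h6 : 0 ≤ K ^ 4 * t ^ 2 := by positivity
    nlinarith [h2.1, h2.2, h3.1, h3.2]
  have hμ2 : 0 < μ ^ 2 := pow_pos h.μ_pos 2
  -- If `‖e‖ ≤ t` there is nothing to do; otherwise `‖e‖ + t ≤ 2 * ‖e‖` and one factor `‖e‖`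
  -- cancels.
  have he1 : ‖e‖ ≤ (7 * K ^ 4 / μ ^ 2 + 1) * t := by
    rcases le_total ‖e‖ t with h1 | h1
    · have : 0 ≤ 7 * K ^ 4 / μ ^ 2 * t := by positivity
      linarith
    · rcases he0.eq_or_lt with h2 | h2
      · rw [← h2]; positivity
      · have h3 : μ ^ 2 * ‖e‖ * ‖e‖ ≤ 7 * K ^ 4 * t * ‖e‖ := by
          have : 7 * K ^ 4 * t * (‖e‖ + t) ≤ 7 * K ^ 4 * t * (‖e‖ + ‖e‖) := by gcongr
          linarith
        have h4 := le_of_mul_le_mul_right h3 h2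
        have h5 : ‖e‖ ≤ 7 * K ^ 4 * t / μ ^ 2 := by
          rw [le_div_iff₀ hμ2]; linarith
        calc ‖e‖ ≤ 7 * K ^ 4 * t / μ ^ 2 := h5
          _ = 7 * K ^ 4 / μ ^ 2 * t := by ring
          _ ≤ _ := by linarith
  set Q := 7 * K ^ 4 / μ ^ 2 + 1 with hQ
  have hQ1 : 1 ≤ Q := by
    have : 0 ≤ 7 * K ^ 4 / μ ^ 2 := by positivity
    linarith
  have hK3 : 1 ≤ K ^ 3 := one_le_pow₀ hK
  constructor
  · refine he1.trans ?_
    have : 0 ≤ Q * t := by positivity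
    have := mul_le_mul_of_nonneg_right (show 1 ≤ 7 * K ^ 3 by linarith) this
    linarith
  · have htQ : t ≤ Q * t := le_mul_of_one_le_left ht0 hQ1
    calc ‖w - ws‖ ≤ K * (2 * K ^ 2 * ‖e‖ + 5 * K ^ 2 * t) := hw
      _ ≤ K * (2 * K ^ 2 * (Q * t) + 5 * K ^ 2 * (Q * t)) := by
          gcongr
      _ = _ := by ring

end RegularBounds

/-! ### Choice of the residual threshold and of the radii. -/

namespace RegularBounds

variable {X Y Z W : Type*} [NormedAddCommGroup X] [InnerProductSpace ℝ X]
    [NormedAddCommGroup Y] [InnerProductSpace ℝ Y] [NormedAddCommGroup Z] [InnerProductSpace ℝ Z]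
    [NormedAddCommGroup W] [InnerProductSpace ℝ W]
    {F : X → Y} {H : X → Z} {A : X →L[ℝ] W} {x₀ : X} {r μ K : ℝ}

/-- Stationarity says that the multipliers represent minus the gradient of the objective, which is
proportional to the residual. -/
theorem norm_multipliers_le (h : RegularBounds F H A x₀ r μ K) {c : Y} {ws : W} {ks : Z} {e : ℝ}
    (hb : ‖F x₀ - c‖ ≤ e)
    (hst : ∀ d, 2 * ⟪F x₀ - c, fderiv ℝ F x₀ d⟫ + ⟪ws, A d⟫ + ⟪ks, fderiv ℝ H x₀ d⟫ = 0) :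
    ‖ws‖ ≤ 2 * K ^ 2 * e ∧ ‖ks‖ ≤ 2 * K ^ 2 * e := by
  have hK := h.one_le_K
  have he : 0 ≤ e := (norm_nonneg _).trans hb
  have hx₀ : x₀ ∈ Metric.ball x₀ r := Metric.mem_ball_self h.r_pos
  have := h.dual x₀ hx₀ ws ks (2 * K * e) (by positivity) fun d => by
    have h1 := abs_inner_apply_le (F x₀ - c) (fderiv ℝ F x₀) d hb (h.tF.norm_fderiv x₀ hx₀)
    have h2 := hst d
    rw [show ⟪ws, A d⟫ + ⟪ks, fderiv ℝ H x₀ d⟫ = -(2 * ⟪F x₀ - c, fderiv ℝ F x₀ d⟫) by linarith,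
      abs_neg, abs_mul, abs_of_pos (two_pos : (0 : ℝ) < 2)]
    linarith
  rwa [show K * (2 * K * e) = 2 * K ^ 2 * e by ring] at this

/-- Local contraction of the Gauss-Newton ALADIN step for a small-residual problem: the
decoupled subproblem has a unique local solution near `x₀`, and the following Gauss-Newton step
reduces the errors of both parts of the iterate. The threshold does not depend on `ρ`. -/
theorem exists_threshold [FiniteDimensional ℝ X] [FiniteDimensional ℝ Z]
    (h : RegularBounds F H A x₀ r μ K) :
    ∃ η : ℝ, 0 < η ∧ ∀ (c : Y) (ws : W) (ks : Z), H x₀ = 0 → A x₀ = 0 →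
      (∀ d, 2 * ⟪F x₀ - c, fderiv ℝ F x₀ d⟫ + ⟪ws, A d⟫ + ⟪ks, fderiv ℝ H x₀ d⟫ = 0) →
      ‖F x₀ - c‖ ^ 2 ≤ η → ∀ ρ : ℝ, 0 < ρ → ∃ r' δ : ℝ, 0 < r' ∧ r' ≤ r ∧ 0 < δ ∧
        ∀ (z : X) (w : W), ‖z - x₀‖ < δ → ‖w - ws‖ < δ →
          (∃! y, y ∈ Metric.ball x₀ r' ∧ H y = 0 ∧
            IsLocalMinOn (fun x => ‖F x - c‖ ^ 2 + ⟪w, A x⟫ + ρ / 2 * ‖x - z‖ ^ 2)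
              {x | H x = 0} y) ∧
          ∀ y ∈ Metric.ball x₀ r', H y = 0 →
            IsLocalMinOn (fun x => ‖F x - c‖ ^ 2 + ⟪w, A x⟫ + ρ / 2 * ‖x - z‖ ^ 2)
              {x | H x = 0} y →
            ∀ D w' k, (∀ d, 2 * ⟪fderiv ℝ F y D, fderiv ℝ F y d⟫ + 2 * ⟪F y - c, fderiv ℝ F y d⟫
              + ⟪w', A d⟫ + ⟪k, fderiv ℝ H y d⟫ = 0) → A (y + D) = 0 → fderiv ℝ H y D = 0 →
            4 * ‖y + D - x₀‖ ≤ ‖z - x₀‖ + ‖w - ws‖ ∧ 4 * ‖w' - ws‖ ≤ ‖z - x₀‖ + ‖w - ws‖ := by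
  have hK := h.one_le_K
  have hK0 : 0 < K := by linarith
  have hμ2 : 0 < μ ^ 2 := pow_pos h.μ_pos 2
  have hμ0 : μ ≠ 0 := h.μ_pos.ne'
  set K' := 7 * K ^ 3 * (7 * K ^ 4 / μ ^ 2 + 1) with hK'
  have hK'0 : 0 < K' := by positivity
  -- Uniformly in `ρ`, the quotient `(2 * K * a + 2 * ρ * b) / (μ ^ 2 + ρ)` is at most `σ * (a + b)`
  -- for nonnegative `a`, `b`.
  set σ := 2 * K / μ ^ 2 + 2 with hσ
  have hσ0 : 0 < σ := by positivity
  -- The first entry is what growth requires; the second makes the combined factor `K' * ε * σ` at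
  -- most `1 / 4`.
  set ε := min (μ ^ 2 / (6 * K)) (1 / (4 * K' * σ)) with hε
  have hε0 : 0 < ε := by positivity
  have hε1 : 6 * K * ε ≤ μ ^ 2 := by
    have : ε ≤ μ ^ 2 / (6 * K) := min_le_left _ _
    rw [le_div_iff₀ (by positivity)] at this
    linarith
  have hε2 : 4 * K' * σ * ε ≤ 1 := by
    have : ε ≤ 1 / (4 * K' * σ) := min_le_right _ _
    rw [le_div_iff₀ (by positivity)] at this
    linarith
  -- A residual at most `e` keeps the multipliers below `ε` and uses up half of `ε` in the
  -- multiplier bound for the subproblem; the other half is left for `L * r'`. Only `r'` and `δ`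
  -- depend on `ρ`.
  set e := ε / (8 * K ^ 4) with he
  have he0 : 0 < e := by positivity
  have he1 : 8 * K ^ 4 * e = ε := by rw [he]; field_simp
  have hK24 : K ^ 2 ≤ K ^ 4 := pow_le_pow_right₀ hK (by norm_num)
  have hK4 : 1 ≤ K ^ 4 := one_le_pow₀ hK
  have hK24e := mul_le_mul_of_nonneg_right hK24 he0.le
  have hK4e := mul_le_mul_of_nonneg_right hK4 he0.le
  refine ⟨e ^ 2, by positivity, fun c ws ks hH hA hst hres ρ hρ => ?_⟩
  have hb : ‖F x₀ - c‖ ≤ e := le_of_sq_le_sq hres he0.le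
  have hbε : ‖F x₀ - c‖ ≤ ε := by linarith
  obtain ⟨hws, hks⟩ := h.norm_multipliers_le hb hst
  have hksε : ‖ks‖ ≤ ε := by linarith
  set L := 2 * K ^ 3 + K ^ 2 + 2 * K * ρ with hL
  have hL1 : 1 ≤ L := by
    have : 1 ≤ K ^ 2 := one_le_pow₀ hK
    have : 0 ≤ 2 * K ^ 3 := by positivity
    have : 0 ≤ 2 * K * ρ := by positivity
    linarith
  set r' := min r (ε / (2 * L)) with hr'
  have hr'0 : 0 < r' := by
    have := h.r_pos
    positivity
  have hr'r : r' ≤ r := min_le_left _ _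
  have hr'L : L * r' ≤ ε / 2 := by
    have : r' ≤ ε / (2 * L) := min_le_right _ _
    rw [le_div_iff₀ (by positivity)] at this
    linarith
  have hr'ε : r' ≤ ε := by
    have := le_mul_of_one_le_left hr'0.le hL1
    linarith
  set δ := min r' ((μ ^ 2 + ρ) * r' / (4 * (K + ρ))) with hδ
  have hδ0 : 0 < δ := by positivity
  have hδr : δ ≤ r' := min_le_left _ _
  have hδ1 : 4 * (K + ρ) * δ ≤ (μ ^ 2 + ρ) * r' := by
    have : δ ≤ (μ ^ 2 + ρ) * r' / (4 * (K + ρ)) := min_le_right _ _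
    rw [le_div_iff₀ (by positivity)] at this
    linarith
  refine ⟨r', δ, hr'0, hr'r, hδ0, fun z w hz hw => ?_⟩
  have hball : Metric.ball x₀ r' ⊆ Metric.ball x₀ r := Metric.ball_subset_ball hr'r
  -- Radius `r' / 2` rather than `r'`, since the existence lemma needs a closed ball strictly inside
  -- the ball of radius `r`.
  obtain ⟨y, hyH, hymin, hylt, hybd⟩ := h.exists_subproblem_solution (w := w) (z := z)
    (r' := r' / 2) hε1 hρ.le hH hbε hksε hst (by linarith) (by linarith) (by
      have h1 := mul_lt_mul_of_pos_left hw hK0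
      have h2 := mul_lt_mul_of_pos_left hz hρ
      linarith)
  have hyb : y ∈ Metric.ball x₀ r' := mem_ball_iff_norm.2 (by linarith)
  have hsmall : ∀ y ∈ Metric.ball x₀ r', 2 * ‖F y - c‖ * K + ‖w‖ * K + ρ * ‖y - z‖
      ≤ (2 * K + 2 * K ^ 3) * e + (2 * K ^ 2 + K + 2 * ρ) * r' := by
    intro y hy
    have h1 : ‖y - x₀‖ ≤ r' := (mem_ball_iff_norm.1 hy).le
    have h2 : ‖F y - c‖ ≤ e + K * r' := by
      have h3 := h.tF.sub x₀ (Metric.mem_ball_self h.r_pos) y (hball hy)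
      have h4 := norm_add_le (F y - F x₀) (F x₀ - c)
      rw [sub_add_sub_cancel] at h4
      have := mul_le_mul_of_nonneg_left h1 hK0.le
      linarith
    have h3 : ‖w‖ ≤ 2 * K ^ 2 * e + r' := by
      have := norm_add_le (w - ws) ws
      rw [sub_add_cancel] at this
      linarith
    have h4 : ‖y - z‖ ≤ 2 * r' := by
      have := norm_sub_le (y - x₀) (z - x₀)
      rw [sub_sub_sub_cancel_right] at this
      linarith
    calc _ ≤ 2 * (e + K * r') * K + (2 * K ^ 2 * e + r') * K + ρ * (2 * r') := by gcongr
      _ = _ := by ring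
  have hsmall' : K * ((2 * K + 2 * K ^ 3) * e + (2 * K ^ 2 + K + 2 * ρ) * r') ≤ ε := by
    have : K * ((2 * K + 2 * K ^ 3) * e + (2 * K ^ 2 + K + 2 * ρ) * r')
      = 2 * (K ^ 2 * e) + 2 * (K ^ 4 * e) + L * r' := by rw [hL]; ring
    linarith
  have hunique : ∀ y' ∈ Metric.ball x₀ r', H y' = 0 →
      IsLocalMinOn (fun x => ‖F x - c‖ ^ 2 + ⟪w, A x⟫ + ρ / 2 * ‖x - z‖ ^ 2)
        {x | H x = 0} y' → y' = y := by
    intro y' hy' hH' hmin'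
    -- Growth around each of the two local solutions, evaluated at the other one: the sum of both
    -- inequalities forces them to coincide.
    have h1 := h.subproblem_growth hε1 hρ.le (hball hy') hH' (hball hyb) hyH
      (hsmall y hyb) hsmall' hymin
    have h2 := h.subproblem_growth hε1 hρ.le (hball hyb) hyH (hball hy') hH'
      (hsmall y' hy') hsmall' hmin'
    rw [norm_sub_rev y y'] at h2
    have h3 : (μ ^ 2 + ρ) / 2 * ‖y' - y‖ ^ 2 ≤ 0 := by linarith
    have h4 : ‖y' - y‖ ^ 2 ≤ 0 := nonpos_of_mul_nonpos_right h3 (by positivity)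
    have h5 : ‖y' - y‖ = 0 := pow_eq_zero_iff two_ne_zero |>.1 (le_antisymm h4 (sq_nonneg _))
    exact sub_eq_zero.1 (norm_eq_zero.1 h5)
  refine ⟨⟨y, ⟨hyb, hyH, hymin⟩, fun y' hy' => hunique y' hy'.1 hy'.2.1 hy'.2.2⟩, ?_⟩
  intro y' hy' hH' hmin' D w' k hD hAD hCD
  obtain rfl := hunique y' hy' hH' hmin'
  obtain ⟨h1, h2⟩ := h.kkt_error (hball hyb) hyH hH hA hbε hksε
    ((mem_ball_iff_norm.1 hyb).le.trans hr'ε) hst hD hAD hCD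
  have h3 : ‖y' - x₀‖ ≤ σ * (‖z - x₀‖ + ‖w - ws‖) := by
    have ha := norm_nonneg (z - x₀)
    have hb := norm_nonneg (w - ws)
    have hc : (μ ^ 2 + ρ) * (σ * (‖z - x₀‖ + ‖w - ws‖))
        = 2 * (K * ‖w - ws‖ + ρ * ‖z - x₀‖) + (2 * K * ‖z - x₀‖ + 2 * μ ^ 2 * ‖z - x₀‖
          + 2 * μ ^ 2 * ‖w - ws‖ + ρ * (2 * K / μ ^ 2) * (‖z - x₀‖ + ‖w - ws‖)
          + 2 * ρ * ‖w - ws‖) := by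
      rw [hσ]; field_simp; ring
    have hd : (0 : ℝ) ≤ (2 * K * ‖z - x₀‖ + 2 * μ ^ 2 * ‖z - x₀‖
          + 2 * μ ^ 2 * ‖w - ws‖ + ρ * (2 * K / μ ^ 2) * (‖z - x₀‖ + ‖w - ws‖)
          + 2 * ρ * ‖w - ws‖) := by positivity
    exact le_of_mul_le_mul_left (by linarith) (show 0 < μ ^ 2 + ρ by positivity)
  have h4 : 4 * (K' * (ε * ‖y' - x₀‖)) ≤ ‖z - x₀‖ + ‖w - ws‖ := by
    calc 4 * (K' * (ε * ‖y' - x₀‖)) ≤ 4 * (K' * (ε * (σ * (‖z - x₀‖ + ‖w - ws‖)))) := by gcongr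
      _ = 4 * K' * σ * ε * (‖z - x₀‖ + ‖w - ws‖) := by ring
      _ ≤ 1 * (‖z - x₀‖ + ‖w - ws‖) := by gcongr
      _ = _ := one_mul _
  exact ⟨by linarith, by linarith⟩

end RegularBounds

/-! ### Smoothness and derivatives of the grid functions. -/

namespace Grid

variable {V : Type} (G : Grid V)

theorem contDiff_coord [Fintype V] {n : WithTop ℕ∞} (k : V × Fin 4) :
    ContDiff ℝ n (fun x : GridState V => x k) :=
  (contDiff_euclidean.1 contDiff_id) k

theorem contDiff_powerFlow [Fintype V] [DecidableEq V] {n : WithTop ℕ∞} : ContDiff ℝ n G.powerFlow := by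
  refine contDiff_euclidean.2 fun kc => ?_
  obtain ⟨k, c⟩ := kc
  have hc := fun k : V × Fin 4 => contDiff_coord (n := n) k
  fin_cases c
  · simp only [powerFlow]
    refine (hc _).sub ((hc _).mul (ContDiff.sum fun l _ => (hc _).mul ?_))
    exact (contDiff_const.mul (Real.contDiff_cos.comp ((hc _).sub (hc _)))).add
      (contDiff_const.mul (Real.contDiff_sin.comp ((hc _).sub (hc _))))
  · simp only [powerFlow]
    refine (hc _).sub ((hc _).mul (ContDiff.sum fun l _ => (hc _).mul ?_))
    exact (contDiff_const.mul (Real.contDiff_sin.comp ((hc _).sub (hc _)))).sub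
      (contDiff_const.mul (Real.contDiff_cos.comp ((hc _).sub (hc _))))

theorem contDiff_flowP [Fintype V] {n : WithTop ℕ∞} (k l : V) : ContDiff ℝ n fun x => G.flowP x k l := by
  have hc := fun k : V × Fin 4 => contDiff_coord (n := n) k
  have hd := (hc (k, 0)).sub (hc (l, 0))
  exact ((hc _).mul (((hc _).mul contDiff_const).sub
    (((hc _).mul contDiff_const).mul (Real.contDiff_cos.comp hd)))).sub
    ((hc _).mul (((hc _).mul contDiff_const).mul (Real.contDiff_sin.comp hd)))

theorem contDiff_flowQ [Fintype V] {n : WithTop ℕ∞} (k l : V) : ContDiff ℝ n fun x => G.flowQ x k l := by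
  have hc := fun k : V × Fin 4 => contDiff_coord (n := n) k
  have hd := (hc (k, 0)).sub (hc (l, 0))
  exact ((hc _).mul (((hc _).mul contDiff_const).sub
    (((hc _).mul contDiff_const).mul (Real.contDiff_cos.comp hd)))).neg.sub
    ((hc _).mul (((hc _).mul contDiff_const).mul (Real.contDiff_sin.comp hd)))

theorem contDiffAt_flowI [Fintype V] {n : WithTop ℕ∞} {k l : V} {x : GridState V} (hx : x (k, 1) ≠ 0) :
    ContDiffAt ℝ n (fun x => G.flowI x k l) x :=
  (((G.contDiff_flowP k l).pow 2).add ((G.contDiff_flowQ k l).pow 2)).contDiffAt.div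
    ((contDiff_coord _).pow 2).contDiffAt (pow_ne_zero 2 hx)

theorem contDiffAt_measure [Fintype V] {n : WithTop ℕ∞} (S : G.Weights) (M : G.Measurements) {x : GridState V}
    (hx : ∀ e ∈ G.lines, x (e.1, 1) ≠ 0) : ContDiffAt ℝ n (G.measure S M) x := by
  refine contDiffAt_euclidean.2 ?_
  rintro (⟨k, c⟩ | ⟨e, c⟩)
  · simp only [measure, Sum.elim_inl, Matrix.mulVec, dotProduct]
    exact ContDiffAt.sum fun j _ => contDiffAt_const.mul
      ((contDiff_coord (k, j)).contDiffAt.sub contDiffAt_const)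
  · simp only [measure, Sum.elim_inr, Matrix.mulVec, dotProduct]
    refine ContDiffAt.sum fun j _ => contDiffAt_const.mul (ContDiffAt.sub ?_ contDiffAt_const)
    fin_cases j
    · exact (G.contDiff_flowP _ _).contDiffAt
    · exact (G.contDiff_flowQ _ _).contDiffAt
    · exact G.contDiffAt_flowI (hx e.1 e.2)

/-- The measurement function depends on the measured values by a translation only. -/
theorem measure_sub_measure (S : G.Weights) (M M' : G.Measurements) (x y : GridState V) :
    G.measure S M x - G.measure S M' x = G.measure S M y - G.measure S M' y := by
  ext kc
  rcases kc with ⟨k, c⟩ | ⟨e, c⟩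
  · simp only [measure, PiLp.sub_apply, Sum.elim_inl, Matrix.mulVec, dotProduct,
      ← Finset.sum_sub_distrib]
    exact Finset.sum_congr rfl fun j _ => by ring
  · simp only [measure, PiLp.sub_apply, Sum.elim_inr, Matrix.mulVec, dotProduct,
      ← Finset.sum_sub_distrib]
    exact Finset.sum_congr rfl fun j _ => by ring

/-- The bus measurements alone suffice: their derivative is multiplication by `CFC.sqrt (S.bus k)`
at each bus, and the root of a positive definite matrix is invertible. -/
theorem injective_fderiv_measure [Fintype V] (S : G.Weights) (hS : ∀ k, (S.bus k).PosDef)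
    (M : G.Measurements) {x : GridState V} (hx : DifferentiableAt ℝ (G.measure S M) x) :
    Function.Injective (fderiv ℝ (G.measure S M) x) := by
  refine (injective_iff_map_eq_zero _).2 fun d hd => ?_
  have hunit : ∀ k, IsUnit (CFC.sqrt (S.bus k)) := fun k => by
    have h1 : CFC.sqrt (S.bus k) * CFC.sqrt (S.bus k) = S.bus k :=
      CFC.sqrt_mul_sqrt_self _ (Matrix.nonneg_iff_posSemidef.2 (hS k).posSemidef)
    have h2 : IsUnit (S.bus k) := (hS k).isUnit
    rw [← h1] at h2
    exact isUnit_of_mul_isUnit_left h2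
  have hcomp : ∀ k c, (CFC.sqrt (S.bus k) *ᵥ fun j => d (k, j)) c = 0 := by
    intro k c
    have h1 : HasFDerivAt (fun y => G.measure S M y (.inl (k, c)))
        ((EuclideanSpace.proj (Sum.inl (k, c)) : _ →L[ℝ] ℝ).comp (fderiv ℝ (G.measure S M) x)) x :=
      (EuclideanSpace.proj (Sum.inl (k, c)) :
        EuclideanSpace ℝ ((V × Fin 4) ⊕ (G.lines × Fin 3)) →L[ℝ] ℝ).hasFDerivAt.comp x
        hx.hasFDerivAt
    have h2 : HasFDerivAt (fun y => G.measure S M y (.inl (k, c)))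
        (∑ j, CFC.sqrt (S.bus k) c j • (EuclideanSpace.proj (k, j) : GridState V →L[ℝ] ℝ)) x := by
      simp only [measure, Sum.elim_inl, Matrix.mulVec, dotProduct]
      refine HasFDerivAt.fun_sum fun j _ => HasFDerivAt.const_mul ?_ _
      exact ((EuclideanSpace.proj (𝕜 := ℝ) (k, j)).hasFDerivAt).sub_const _
    have h3 := congrArg (fun T : GridState V →L[ℝ] ℝ => T d) (h2.unique h1)
    simp only [ContinuousLinearMap.comp_apply, hd, map_zero] at h3
    simpa [Matrix.mulVec, dotProduct] using h3
  ext ⟨k, c⟩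
  have h0 : (CFC.sqrt (S.bus k) *ᵥ fun j => d (k, j)) = 0 := funext (hcomp k)
  have h1 := Matrix.mulVec_injective_of_isUnit (hunit k) (h0.trans (Matrix.mulVec_zero _).symm)
  exact congrFun h1 c

/-- The embedding of the net powers into the states. -/
def powerState (w : EuclideanSpace ℝ (V × Fin 2)) : GridState V :=
  WithLp.toLp 2 fun kc => ![0, 0, w (kc.1, 0), w (kc.1, 1)] kc.2

/-- The net powers appear only as the leading terms of the equations, with coefficient one. Hence
`powerState` is a right inverse of the derivative of `powerFlow` at every state. -/
theorem powerFlow_add_powerState [Fintype V] [DecidableEq V] (x : GridState V) (w : EuclideanSpace ℝ (V × Fin 2)) :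
    G.powerFlow (x + powerState w) = G.powerFlow x + w := by
  ext ⟨k, c⟩
  fin_cases c
  · simp [powerFlow, powerState]; ring
  · simp [powerFlow, powerState]; ring

theorem fderiv_powerFlow_powerState [Fintype V] [DecidableEq V] (x : GridState V) (w : EuclideanSpace ℝ (V × Fin 2)) :
    fderiv ℝ G.powerFlow x (powerState w) = w := by
  have h1 := ((G.contDiff_powerFlow (n := 1)).differentiable one_ne_zero
    x).hasFDerivAt.hasLineDerivAt (powerState w)
  have h2 : HasLineDerivAt ℝ G.powerFlow w x (powerState w) := by
    have h3 : (fun t : ℝ => G.powerFlow (x + t • powerState w))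
        = fun t => G.powerFlow x + t • w := by
      funext t
      rw [← powerFlow_add_powerState]
      congr 2
      ext ⟨k, c⟩
      fin_cases c <;> simp [powerState]
    unfold HasLineDerivAt
    rw [h3]
    simpa using ((hasDerivAt_id (0 : ℝ)).smul_const w).const_add (G.powerFlow x)
  exact HasDerivAt.unique h1 h2

end Grid

/-! ### Separable functions on products of Euclidean spaces. -/

section BlockSeparable

variable {ι : Type*} [Fintype ι] {E G : ι → Type*} [∀ i, NormedAddCommGroup (E i)]
  [∀ i, NormedSpace ℝ (E i)] [∀ i, NormedAddCommGroup (G i)] [∀ i, NormedSpace ℝ (G i)]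

theorem PiLp.differentiableAt_update [DecidableEq ι] (y : PiLp 2 E) (i : ι) (x : E i) :
    DifferentiableAt ℝ (fun x => (WithLp.toLp 2 (Function.update y.ofLp i x) : PiLp 2 E)) x :=
  ((PiLp.continuousLinearEquiv 2 ℝ E).symm.toContinuousLinearMap.differentiableAt).comp x
    (hasFDerivAt_update y.ofLp x).differentiableAt

theorem PiLp.differentiableAt_component {f : ∀ i, E i → G i} {y : PiLp 2 E}
    (h : DifferentiableAt ℝ (fun z : PiLp 2 E => (WithLp.toLp 2 fun i => f i (z i) : PiLp 2 G)) y)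
    (i : ι) : DifferentiableAt ℝ (f i) (y i) := by
  classical
  have h0 : (WithLp.toLp 2 (Function.update y.ofLp i (y i)) : PiLp 2 E) = y := by simp
  rw [← h0] at h
  have h1 := (PiLp.proj (𝕜 := ℝ) 2 G i).differentiableAt.comp (y i)
    (h.comp (y i) (PiLp.differentiableAt_update y i (y i)))
  refine h1.congr_of_eventuallyEq (Eventually.of_forall fun x => ?_)
  simp

theorem PiLp.fderiv_blockwise {f : ∀ i, E i → G i} {y : PiLp 2 E}
    (h : DifferentiableAt ℝ (fun z : PiLp 2 E => (WithLp.toLp 2 fun i => f i (z i) : PiLp 2 G)) y)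
    (d : PiLp 2 E) :
    fderiv ℝ (fun z : PiLp 2 E => (WithLp.toLp 2 fun i => f i (z i) : PiLp 2 G)) y d
      = WithLp.toLp 2 fun i => fderiv ℝ (f i) (y i) (d i) := by
  ext i
  have h1 := (PiLp.proj (𝕜 := ℝ) 2 G i).hasFDerivAt.comp y h.hasFDerivAt
  have h2 := (PiLp.differentiableAt_component h i).hasFDerivAt.comp y
    (PiLp.proj (𝕜 := ℝ) 2 E i).hasFDerivAt
  exact congrArg (fun T : PiLp 2 E →L[ℝ] G i => T d) (h1.unique h2)

/-- In one direction a single block varies while the others stay frozen at `y`; in the other, the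
finitely many neighbourhoods are intersected. -/
theorem PiLp.isLocalMinOn_sum_iff {φ : ∀ i, E i → ℝ} {C : ∀ i, Set (E i)} {y : PiLp 2 E}
    (hy : ∀ i, y i ∈ C i) :
    IsLocalMinOn (fun x : PiLp 2 E => ∑ i, φ i (x i)) {x | ∀ i, x i ∈ C i} y
      ↔ ∀ i, IsLocalMinOn (φ i) (C i) (y i) := by
  classical
  constructor
  · intro h i
    have hcont : Tendsto (fun x => (WithLp.toLp 2 (Function.update y.ofLp i x) : PiLp 2 E))
        (𝓝[C i] (y i)) (𝓝[{x | ∀ i, x i ∈ C i}] y) := by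
      refine tendsto_nhdsWithin_iff.2 ⟨?_, ?_⟩
      · have := (PiLp.differentiableAt_update y i (y i)).continuousAt.tendsto
        simp only [Function.update_eq_self] at this
        exact this.mono_left nhdsWithin_le_nhds
      · filter_upwards [self_mem_nhdsWithin] with x hx j
        rcases eq_or_ne j i with rfl | hj
        · simpa using hx
        · simpa [hj] using hy j
    filter_upwards [hcont.eventually h] with x hx
    have hs : ∑ j, (φ j (Function.update y.ofLp i x j) - φ j (y j)) = φ i x - φ i (y i) := by
      rw [Finset.sum_eq_single i (fun j _ hj => by simp [hj]) (by simp)]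
      simp
    rw [Finset.sum_sub_distrib] at hs
    linarith
  · intro h
    have hproj : ∀ i, Tendsto (fun x : PiLp 2 E => x i) (𝓝[{x | ∀ i, x i ∈ C i}] y)
        (𝓝[C i] (y i)) := fun i => by
      refine tendsto_nhdsWithin_iff.2 ⟨?_, ?_⟩
      · exact ((PiLp.proj (𝕜 := ℝ) 2 E i).continuous.tendsto y).mono_left nhdsWithin_le_nhds
      · filter_upwards [self_mem_nhdsWithin] with x hx using hx i
    filter_upwards [eventually_all.2 fun i => (hproj i).eventually (h i)] with x hx
    exact Finset.sum_le_sum fun i _ => hx i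

end BlockSeparable

/-! ### The partitioned network as one constrained least-squares problem. -/

namespace PartitionedGrid

variable {N R : ℕ} (P : PartitionedGrid N R)

/-- The space of the measurements of all regions. -/
abbrev MeasSpace : Type :=
  PiLp 2 fun i : Fin R => EuclideanSpace ℝ ((P.RegBus i × Fin 4) ⊕ ((P.regGrid i).lines × Fin 3))

/-- The measurement function of the whole partitioned network. -/
def FAll (S : P.Weights) (M : P.Measurements) (z : P.States) : P.MeasSpace :=
  WithLp.toLp 2 fun i => P.F S M i (z i)

/-- The consensus constraint `∑ i, A i z i` as a linear map. -/
def AAll : P.States →L[ℝ] P.ConsMult :=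
  ∑ i, (LinearMap.toContinuousLinearMap
    { toFun := P.applyA i
      map_add' := fun x y => by simp [applyA, Matrix.mulVec_add]
      map_smul' := fun a x => by simp [applyA, Matrix.mulVec_smul] } :
    GridState (P.RegBus i) →L[ℝ] P.ConsMult).comp (PiLp.proj (𝕜 := ℝ) 2 _ i)

theorem AAll_apply (z : P.States) : P.AAll z = ∑ i, P.applyA i (z i) := by
  simp [AAll]
  rfl

theorem residuum_eq (S : P.Weights) (M : P.Measurements) (z : P.States) :
    P.residuum S M z = ‖P.FAll S M z‖ ^ 2 := by
  rw [PiLp.norm_sq_eq_of_L2]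
  rfl

theorem HAll_eq_zero_iff (z : P.States) : P.HAll z = 0 ↔ ∀ i, P.H i (z i) = 0 := by
  refine ⟨fun h i => congrArg (fun k : P.FlowMult => k i) h, fun h => ?_⟩
  ext i : 1
  exact h i

theorem parallelStep_iff (S : P.Weights) (M : P.Measurements) (ρ : ℝ) (s : P.Iterate)
    (y : P.States) : P.ParallelStep S M ρ s y ↔ P.HAll y = 0 ∧
      IsLocalMinOn (fun x => ‖P.FAll S M x‖ ^ 2 + ⟪s.snd, P.AAll x⟫ + ρ / 2 * ‖x - s.fst‖ ^ 2)
        {x | P.HAll x = 0} y := by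
  have hfun : (fun x => ‖P.FAll S M x‖ ^ 2 + ⟪s.snd, P.AAll x⟫ + ρ / 2 * ‖x - s.fst‖ ^ 2)
      = fun x => ∑ i, (‖P.F S M i (x i)‖ ^ 2 + ⟪s.snd, P.applyA i (x i)⟫
        + ρ / 2 * ‖x i - s.fst i‖ ^ 2) := by
    funext x
    rw [← residuum_eq, AAll_apply, inner_sum, PiLp.norm_sq_eq_of_L2, Finset.mul_sum,
      Finset.sum_add_distrib, Finset.sum_add_distrib]
    rfl
  have hset : {x : P.States | P.HAll x = 0} = {x | ∀ i, x i ∈ {x | P.H i x = 0}} :=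
    Set.ext fun x => P.HAll_eq_zero_iff x
  rw [hfun, hset, HAll_eq_zero_iff, ParallelStep, forall_and]
  exact and_congr_right fun hy => (PiLp.isLocalMinOn_sum_iff
    (φ := fun i x => ‖P.F S M i x‖ ^ 2 + ⟪s.snd, P.applyA i x⟫ + ρ / 2 * ‖x - s.fst i‖ ^ 2)
    (C := fun i => {x | P.H i x = 0}) hy).symm

theorem contDiff_HAll {n : WithTop ℕ∞} : ContDiff ℝ n P.HAll :=
  (contDiff_piLp 2).2 fun i =>
    (P.regGrid i).contDiff_powerFlow.comp ((contDiff_piLp 2).1 contDiff_id i)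

theorem fderiv_HAll (y d : P.States) :
    fderiv ℝ P.HAll y d = WithLp.toLp 2 fun i => fderiv ℝ (P.H i) (y i) (d i) :=
  PiLp.fderiv_blockwise ((P.contDiff_HAll (n := 1)).differentiable one_ne_zero y) d

theorem contDiffAt_FAll {n : WithTop ℕ∞} (S : P.Weights) (M : P.Measurements) {z : P.States}
    (hv : ∀ i, ∀ e ∈ (P.regGrid i).lines, z i (e.1, 1) ≠ 0) : ContDiffAt ℝ n (P.FAll S M) z :=
  (contDiffAt_piLp 2).2 fun i =>
    ContDiffAt.comp (f := fun z : P.States => z i) z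
      ((P.regGrid i).contDiffAt_measure (S i) (M i) (hv i))
      ((contDiffAt_piLp 2).1 contDiffAt_id i)

theorem fderiv_FAll {S : P.Weights} {M : P.Measurements} {y : P.States}
    (h : DifferentiableAt ℝ (P.FAll S M) y) (d : P.States) :
    fderiv ℝ (P.FAll S M) y d = WithLp.toLp 2 fun i => fderiv ℝ (P.F S M i) (y i) (d i) :=
  PiLp.fderiv_blockwise h d

/-- Changing the measured values only shifts the measurement function by a constant vector, so all
derivatives and local constants can be taken from one reference choice. -/
theorem FAll_eq_sub (S : P.Weights) (M M' : P.Measurements) (z : P.States) :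
    P.FAll S M = fun x => P.FAll S M' x - (P.FAll S M' z - P.FAll S M z) := by
  funext x
  rw [eq_sub_iff_add_eq, ← eq_sub_iff_add_eq', ← neg_sub, neg_eq_iff_eq_neg, neg_sub]
  ext i : 1
  exact (P.regGrid i).measure_sub_measure (S i) (M i) (M' i) (z i) (x i)

theorem injective_fderiv_FAll {S : P.Weights} (hS : ∀ i k, ((S i).bus k).PosDef)
    {M : P.Measurements} {y : P.States} (h : DifferentiableAt ℝ (P.FAll S M) y) :
    Function.Injective (fderiv ℝ (P.FAll S M) y) := by
  refine (injective_iff_map_eq_zero _).2 fun d hd => ?_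
  rw [fderiv_FAll P h] at hd
  ext i : 1
  refine (injective_iff_map_eq_zero _).1 ((P.regGrid i).injective_fderiv_measure (S i) (hS i) (M i)
    (PiLp.differentiableAt_component h i)) _ ?_
  exact congrArg (fun k : P.MeasSpace => k i) hd

/-- The coupling matrices read only components `0` and `1`, where `powerState` vanishes. -/
theorem AAll_powerState (k : P.FlowMult) :
    P.AAll (WithLp.toLp 2 fun i => Grid.powerState (k i)) = 0 := by
  rw [AAll_apply]
  refine Finset.sum_eq_zero fun i _ => ?_
  ext ⟨e, c⟩
  simp only [applyA, Matrix.mulVec, dotProduct, PiLp.zero_apply]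
  refine Finset.sum_eq_zero fun bd _ => ?_
  obtain ⟨b, d⟩ := bd
  fin_cases d
  · simp [Grid.powerState]
  · simp [Grid.powerState]
  · have : ¬ (c.val = 2) := by omega
    simp [A, this]
  · have : ¬ (c.val = 3) := by omega
    simp [A, this]

theorem fderiv_HAll_powerState (y : P.States) (k : P.FlowMult) :
    fderiv ℝ P.HAll y (WithLp.toLp 2 fun i => Grid.powerState (k i)) = k := by
  rw [fderiv_HAll]
  ext i : 1
  exact (P.regGrid i).fderiv_powerFlow_powerState (y i) (k i)

/-- A state of all regions with a prescribed consensus violation. -/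
def consensusLift (w : P.ConsMult) : P.States :=
  WithLp.toLp 2 fun _ => WithLp.toLp 2 fun bd =>
    match bd.1 with
    | .inl _ => 0
    | .inr a =>
      if h : a.1.1 < a.1.2 then
        if hd : bd.2.val < 2 then
          w (⟨a.1, a.2.1, fun h' => a.2.2.2 (h'.symm.trans a.2.2.1), h⟩, ⟨bd.2.val, hd⟩)
        else 0
      else 0

/-- The row of a pair `(m, n)` with `m < n` has the entry `1` at the bus `(m, n)` and `-1` at `(n,
m)`. The lift is supported on the former kind of bus, so exactly one term of the double sum can
survive. -/
theorem AAll_consensusLift (w : P.ConsMult) : P.AAll (P.consensusLift w) = w := by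
  ext ⟨e, c⟩
  rw [AAll_apply]
  have h0 : (∑ i, P.applyA i (P.consensusLift w i)) (e, c)
      = ∑ i, ∑ bd, P.A i (e, c) bd * P.consensusLift w i bd := by
    simp [applyA, Matrix.mulVec, dotProduct]
  have hc : c.val < 4 := by omega
  have hzero : ∀ i bd, P.A i (e, c) bd * P.consensusLift w i bd ≠ 0 →
      ∃ a : P.AuxBus i, bd.1 = .inr a ∧ a.1 = e.1 ∧ bd.2.val = c.val := by
    rintro i ⟨b | a, d⟩ hne
    · simp [consensusLift] at hne
    · refine ⟨a, rfl, ?_, ?_⟩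
      · by_contra hae
        apply hne
        by_cases hsw : a.1 = e.1.swap
        · have h1 : ¬ a.1.1 < a.1.2 := by
            rw [hsw]
            exact not_lt.2 e.2.2.2.le
          simp [consensusLift, h1]
        · simp [A, hae, hsw]
      · by_contra hcd
        apply hne
        have : ¬ c.val = d.val := fun h => hcd h.symm
        simp [A, this]
  set i₀ := P.reg e.1.1 with hi₀
  let a₀ : P.AuxBus i₀ := ⟨e.1, e.2.1, rfl, fun h => e.2.2.1 h.symm⟩
  rw [h0, Finset.sum_eq_single i₀, Finset.sum_eq_single (Sum.inr a₀, ⟨c.val, hc⟩)]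
  · have hlt : e.1.1 < e.1.2 := e.2.2.2
    simp [A, consensusLift, a₀, hlt]
    exact fun h => absurd h (by omega)
  · rintro ⟨b, d⟩ - hne
    by_contra h
    obtain ⟨a, h1, h2, h3⟩ := hzero i₀ _ h
    apply hne
    simp only at h1 h3
    rw [h1]
    exact Prod.ext (congrArg Sum.inr (Subtype.ext h2)) (Fin.ext h3)
  · simp
  · intro i _ hi
    refine Finset.sum_eq_zero fun bd _ => ?_
    by_contra h
    obtain ⟨a, -, h2, -⟩ := hzero i _ h
    apply hi
    rw [← a.2.2.1, h2]
  · simp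

/-- The consensus constraint and the power-flow equations are jointly regular. -/
theorem surjective_AAll_fderiv_HAll (y : P.States) :
    Function.Surjective fun d => (P.AAll d, fderiv ℝ P.HAll y d) := by
  rintro ⟨w, k⟩
  -- Triangular solution: the lift settles the consensus part, then net powers, invisible to `AAll`,
  -- correct the power-flow part.
  refine ⟨P.consensusLift w + WithLp.toLp 2 fun i => Grid.powerState
    ((k - fderiv ℝ P.HAll y (P.consensusLift w)) i), ?_⟩
  simp only [map_add]
  rw [AAll_powerState, fderiv_HAll_powerState, AAll_consensusLift, add_zero, add_sub_cancel]

theorem inner_piLp_single {E G : Fin R → Type*} [∀ i, NormedAddCommGroup (E i)]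
    [∀ i, InnerProductSpace ℝ (E i)] [∀ i, NormedAddCommGroup (G i)] [∀ i, InnerProductSpace ℝ (G i)]
    (T : ∀ i, E i →L[ℝ] G i) (v : PiLp 2 G) (i : Fin R) (d : E i) :
    ⟪v, (WithLp.toLp 2 fun j => T j (Pi.single i d j) : PiLp 2 G)⟫ = ⟪v i, T i d⟫ := by
  rw [PiLp.inner_apply, Finset.sum_eq_single i]
  · simp
  · intro j _ hj
    simp [hj]
  · simp

/-- The coupled quadratic program is equivalent to its optimality system. -/
theorem isQPSolution_iff (S : P.Weights) (M : P.Measurements) {y D : P.States} {lam : P.ConsMult}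
    (h : DifferentiableAt ℝ (P.FAll S M) y) :
    P.IsQPSolution S M y D lam ↔ ∃ k : P.FlowMult,
      (∀ d, 2 * ⟪fderiv ℝ (P.FAll S M) y D, fderiv ℝ (P.FAll S M) y d⟫
        + 2 * ⟪P.FAll S M y, fderiv ℝ (P.FAll S M) y d⟫ + ⟪lam, P.AAll d⟫
        + ⟪k, fderiv ℝ P.HAll y d⟫ = 0) ∧ P.AAll (y + D) = 0 ∧ fderiv ℝ P.HAll y D = 0 := by
  have hfeas : ∀ D, D ∈ P.qpFeasible y ↔ P.AAll (y + D) = 0 ∧ fderiv ℝ P.HAll y D = 0 := by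
    intro D
    rw [AAll_apply, fderiv_HAll]
    refine and_congr_right fun _ => ⟨fun h => ?_, fun h i => congrArg (fun k : P.FlowMult => k i) h⟩
    ext i : 1
    exact h i
  have hobj : ∀ D, P.qpObjective S M y D = ‖fderiv ℝ (P.FAll S M) y D‖ ^ 2
      + 2 * ⟪fderiv ℝ (P.FAll S M) y D, P.FAll S M y⟫ := by
    intro D
    rw [fderiv_FAll P h, PiLp.norm_sq_eq_of_L2, PiLp.inner_apply, Finset.mul_sum,
      ← Finset.sum_add_distrib]
    rfl
  have hgrad : ∀ k : P.FlowMult,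
      (∀ (i : Fin R) (d : GridState (P.RegBus i)),
        2 * ⟪fderiv ℝ (P.F S M i) (y i) (D i), fderiv ℝ (P.F S M i) (y i) d⟫
          + 2 * ⟪P.F S M i (y i), fderiv ℝ (P.F S M i) (y i) d⟫
          + ⟪lam, P.applyA i d⟫ + ⟪k i, fderiv ℝ (P.H i) (y i) d⟫ = 0) ↔
      ∀ d, 2 * ⟪fderiv ℝ (P.FAll S M) y D, fderiv ℝ (P.FAll S M) y d⟫
        + 2 * ⟪P.FAll S M y, fderiv ℝ (P.FAll S M) y d⟫ + ⟪lam, P.AAll d⟫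
        + ⟪k, fderiv ℝ P.HAll y d⟫ = 0 := by
    intro k
    constructor
    · intro hk d
      rw [fderiv_FAll P h, fderiv_FAll P h, fderiv_HAll, AAll_apply, inner_sum, PiLp.inner_apply,
        PiLp.inner_apply, PiLp.inner_apply, Finset.mul_sum, Finset.mul_sum,
        ← Finset.sum_add_distrib, ← Finset.sum_add_distrib, ← Finset.sum_add_distrib]
      exact Finset.sum_eq_zero fun i _ => hk i (d i)
    · intro hk i d
      have h1 := hk (WithLp.toLp 2 (Pi.single i d))
      rw [fderiv_FAll P h (WithLp.toLp 2 (Pi.single i d)), fderiv_HAll, inner_piLp_single,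
        inner_piLp_single, inner_piLp_single, AAll_apply, Finset.sum_eq_single i,
        fderiv_FAll P h] at h1
      · simpa [FAll] using h1
      · intro j _ hj
        simp [applyA, hj]
      · simp
  constructor
  · rintro ⟨hD, -, k, hk⟩
    exact ⟨k, (hgrad k).1 hk, (hfeas D).1 hD⟩
  · rintro ⟨k, hk, hA, hH⟩
    refine ⟨(hfeas D).2 ⟨hA, hH⟩, fun D' hD' => ?_, k, (hgrad k).2 hk⟩
    obtain ⟨hA', hH'⟩ := (hfeas D').1 hD'
    -- The multiplier terms vanish on a difference of feasible points, so the gradient does too, and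
    -- the objectives differ by the square of the norm of `fderiv ℝ (P.FAll S M) y (D' - D)`.
    have h1 := hk (D' - D)
    have h2 : P.AAll (D' - D) = 0 := by
      rw [← add_sub_add_left_eq_sub D' D y, map_sub, hA, hA', sub_zero]
    rw [h2, map_sub (fderiv ℝ P.HAll y), hH, hH', sub_zero, inner_zero_right, inner_zero_right,
      add_zero, add_zero, map_sub, inner_sub_right, inner_sub_right] at h1
    have h3 := norm_sub_sq_real (fderiv ℝ (P.FAll S M) y D') (fderiv ℝ (P.FAll S M) y D)
    have h4 := sq_nonneg ‖fderiv ℝ (P.FAll S M) y D' - fderiv ℝ (P.FAll S M) y D‖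
    have h5 := real_inner_self_eq_norm_sq (fderiv ℝ (P.FAll S M) y D)
    have h6 := real_inner_comm (fderiv ℝ (P.FAll S M) y D') (fderiv ℝ (P.FAll S M) y D)
    have h7 := real_inner_comm (fderiv ℝ (P.FAll S M) y D') (P.FAll S M y)
    have h8 := real_inner_comm (fderiv ℝ (P.FAll S M) y D) (P.FAll S M y)
    change P.qpObjective S M y D ≤ P.qpObjective S M y D'
    rw [hobj, hobj]
    linarith

end PartitionedGrid

/-! ### Orbits of a contracting relation. -/

/-- A relation that is functional and contracts towards `p` on a ball about `p` has unique
orbits, and these converge to `p`. -/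
theorem existsUnique_orbit_of_contraction {I : Type*} [NormedAddCommGroup I] {T : I → I → Prop}
    {p : I} {δ q : ℝ} (hq0 : 0 ≤ q) (hq1 : q < 1) (hex : ∀ s ∈ Metric.ball p δ, ∃! t, T s t)
    (hT : ∀ s ∈ Metric.ball p δ, ∀ t, T s t → ‖t - p‖ ≤ q * ‖s - p‖) :
    ∀ s ∈ Metric.ball p δ, (∃! w : ℕ → I, w 0 = s ∧ ∀ n, T (w n) (w (n + 1))) ∧
      ∀ w : ℕ → I, w 0 = s → (∀ n, T (w n) (w (n + 1))) →
        (∀ n, ‖w (n + 1) - p‖ ≤ q * ‖w n - p‖) ∧ Tendsto w atTop (𝓝 p) := by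
  intro s hs
  have hstay : ∀ s ∈ Metric.ball p δ, ∀ t, T s t → t ∈ Metric.ball p δ := by
    intro s hs t hst
    rw [mem_ball_iff_norm] at hs ⊢
    have h1 := hT s (mem_ball_iff_norm.2 hs) t hst
    have h2 := mul_le_of_le_one_left (norm_nonneg (s - p)) hq1.le
    linarith
  have horbit : ∀ w : ℕ → I, w 0 = s → (∀ n, T (w n) (w (n + 1))) →
      ∀ n, w n ∈ Metric.ball p δ := by
    intro w h0 hw n
    induction n with
    | zero => rwa [h0]
    | succ n ih => exact hstay _ ih _ (hw n)
  constructor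
  · choose! f hf hfu using hex
    have hmem : ∀ n, f^[n] s ∈ Metric.ball p δ := by
      intro n
      induction n with
      | zero => exact hs
      | succ n ih =>
        rw [Function.iterate_succ_apply']
        exact hstay _ ih _ (hf _ ih)
    refine ⟨fun n => f^[n] s, ⟨rfl, fun n => ?_⟩, fun w ⟨h0, hw⟩ => funext fun n => ?_⟩
    · simp only [Function.iterate_succ_apply']
      exact hf _ (hmem n)
    · induction n with
      | zero => exact h0
      | succ n ih =>
        rw [Function.iterate_succ_apply', hfu _ (horbit w h0 hw n) _ (hw n), ih]
  · intro w h0 hw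
    have hc : ∀ n, ‖w (n + 1) - p‖ ≤ q * ‖w n - p‖ := fun n => hT _ (horbit w h0 hw n) _ (hw n)
    refine ⟨hc, tendsto_iff_norm_sub_tendsto_zero.2 ?_⟩
    have hgeo : ∀ n, ‖w n - p‖ ≤ q ^ n * ‖s - p‖ := by
      intro n
      induction n with
      | zero => simp [h0]
      | succ n ih =>
        calc _ ≤ q * ‖w n - p‖ := hc n
          _ ≤ q * (q ^ n * ‖s - p‖) := by gcongr
          _ = _ := by ring
    refine squeeze_zero (fun _ => norm_nonneg _) hgeo ?_
    simpa using (tendsto_pow_atTop_nhds_zero_of_lt_one hq0 hq1).mul_const ‖s - p‖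

namespace PartitionedGrid

variable {N R : ℕ} (P : PartitionedGrid N R)

theorem IsLocalSolution.stationary_all {S : P.Weights} {M : P.Measurements} {z : P.States}
    {lam : P.ConsMult} {kap : P.FlowMult} (h : P.IsLocalSolution S M z lam kap)
    (hF : DifferentiableAt ℝ (P.FAll S M) z) (d : P.States) :
    2 * ⟪P.FAll S M z, fderiv ℝ (P.FAll S M) z d⟫ + ⟪lam, P.AAll d⟫
      + ⟪kap, fderiv ℝ P.HAll z d⟫ = 0 := by
  rw [fderiv_FAll P hF, fderiv_HAll, AAll_apply, inner_sum, PiLp.inner_apply, PiLp.inner_apply,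
    Finset.mul_sum, ← Finset.sum_add_distrib, ← Finset.sum_add_distrib]
  exact Finset.sum_eq_zero fun i _ => h.stationary i (d i)

theorem consensusStep_iff (S : P.Weights) (M : P.Measurements) (y : P.States) (t : P.Iterate) :
    P.ConsensusStep S M y t ↔ P.IsQPSolution S M y (t.fst - y) t.snd := by
  constructor
  · rintro ⟨D, hD, h⟩
    rwa [hD, add_sub_cancel_left]
  · exact fun h => ⟨t.fst - y, (add_sub_cancel _ _).symm, h⟩

end PartitionedGrid

end

/-! ### Assembly of the theorem. -/

theorem theorem1 {N R : ℕ} (P : PartitionedGrid N R) (S : P.Weights)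
    (hSbus : ∀ i k, ((S i).bus k).PosDef) (hSline : ∀ i e, ((S i).line e).PosSemidef)
    (zs : P.States)
    (hv : ∀ i, ∀ e ∈ (P.regGrid i).lines, zs i (e.1, 1) ≠ 0)
    (hLICQ : Function.Surjective (fderiv ℝ P.HAll zs)) :
    ∃ η : ℝ, 0 < η ∧
      ∀ (M : P.Measurements) (lams : P.ConsMult) (kaps : P.FlowMult),
        P.IsLocalSolution S M zs lams kaps → P.residuum S M zs ≤ η →
        ∀ ρ : ℝ, 0 < ρ →
          ∃ r δ q : ℝ, 0 < r ∧ 0 < δ ∧ 0 ≤ q ∧ q < 1 ∧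
            (∀ s ∈ Metric.ball (WithLp.toLp 2 (zs, lams) : P.Iterate) δ,
              (∃! y, y ∈ Metric.ball zs r ∧ P.ParallelStep S M ρ s y) ∧
              (∃! t, P.AladinStep S M ρ (Metric.ball zs r) s t) ∧
              ∀ t, P.AladinStep S M ρ (Metric.ball zs r) s t →
                ‖t - WithLp.toLp 2 (zs, lams)‖ ≤ q * ‖s - WithLp.toLp 2 (zs, lams)‖) ∧
            ∀ s ∈ Metric.ball (WithLp.toLp 2 (zs, lams) : P.Iterate) δ,
              (∃! w : ℕ → P.Iterate, w 0 = s ∧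
                ∀ n, P.AladinStep S M ρ (Metric.ball zs r) (w n) (w (n + 1))) ∧
              ∀ w : ℕ → P.Iterate, w 0 = s →
                (∀ n, P.AladinStep S M ρ (Metric.ball zs r) (w n) (w (n + 1))) →
                (∀ n, ‖w (n + 1) - WithLp.toLp 2 (zs, lams)‖
                  ≤ q * ‖w n - WithLp.toLp 2 (zs, lams)‖) ∧
                Tendsto w atTop (𝓝 (WithLp.toLp 2 (zs, lams))) := by
  -- Zero measured values serve as the reference, so that `r₀`, `μ`, `K` and `η` are chosen before
  -- `M`.
  let M₀ : P.Measurements := fun _ => ⟨fun _ _ => 0, fun _ _ => 0⟩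
  have hF₀ : ContDiffAt ℝ 2 (P.FAll S M₀) zs := P.contDiffAt_FAll S M₀ hv
  obtain ⟨r₀, μ, K, hreg⟩ := exists_regularBounds (A := P.AAll) hF₀ P.contDiff_HAll.contDiffAt
    (P.injective_fderiv_FAll hSbus (hF₀.differentiableAt two_ne_zero))
    (P.surjective_AAll_fderiv_HAll zs)
  obtain ⟨η, hη, hmain⟩ := hreg.exists_threshold
  refine ⟨η, hη, fun M lams kaps hsol hres ρ hρ => ?_⟩
  obtain ⟨c, hFc⟩ : ∃ c, P.FAll S M = fun x => P.FAll S M₀ x - c := ⟨_, P.FAll_eq_sub S M M₀ zs⟩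
  have hFc' : ∀ x, P.FAll S M x = P.FAll S M₀ x - c := congrFun hFc
  have hfd : ∀ y, fderiv ℝ (P.FAll S M) y = fderiv ℝ (P.FAll S M₀) y := fun y => by
    rw [hFc, fderiv_sub_const]
  have hdiff : ∀ y ∈ Metric.ball zs r₀, DifferentiableAt ℝ (P.FAll S M) y := fun y hy => by
    rw [hFc]
    exact (hreg.tF.strict y hy).hasFDerivAt.differentiableAt.sub_const c
  have hzs : zs ∈ Metric.ball zs r₀ := Metric.mem_ball_self hreg.r_pos
  have hA : P.AAll zs = 0 := (P.AAll_apply zs).trans hsol.mem_feasible.1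
  have hH : P.HAll zs = 0 := (P.HAll_eq_zero_iff zs).2 hsol.mem_feasible.2
  obtain ⟨r, δ, hr, hrr, hδ, hstep⟩ := hmain c lams kaps hH hA (fun d => by
      have := hsol.stationary_all P (hdiff zs hzs) d
      rwa [hfd, hFc'] at this) (by rwa [P.residuum_eq, hFc'] at hres) ρ hρ
  set p : P.Iterate := WithLp.toLp 2 (zs, lams) with hp
  have hball : Metric.ball zs r ⊆ Metric.ball zs r₀ := Metric.ball_subset_ball hrr
  have hnorm : ∀ s : P.Iterate, ‖s - p‖ ^ 2 = ‖s.fst - zs‖ ^ 2 + ‖s.snd - lams‖ ^ 2 := fun s =>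
    WithLp.prod_norm_sq_eq_of_L2 (s - p)
  have hcons : ∀ y ∈ Metric.ball zs r, ∀ t, P.ConsensusStep S M y t ↔ ∃ k : P.FlowMult,
      (∀ d, 2 * ⟪fderiv ℝ (P.FAll S M₀) y (t.fst - y), fderiv ℝ (P.FAll S M₀) y d⟫
        + 2 * ⟪P.FAll S M₀ y - c, fderiv ℝ (P.FAll S M₀) y d⟫ + ⟪t.snd, P.AAll d⟫
        + ⟪k, fderiv ℝ P.HAll y d⟫ = 0) ∧ P.AAll (y + (t.fst - y)) = 0
        ∧ fderiv ℝ P.HAll y (t.fst - y) = 0 := by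
    intro y hy t
    rw [P.consensusStep_iff, P.isQPSolution_iff S M (hdiff y (hball hy)), hfd, hFc']
  have hlocal : ∀ s ∈ Metric.ball p δ,
      (∃! y, y ∈ Metric.ball zs r ∧ P.ParallelStep S M ρ s y) ∧
      (∃! t, P.AladinStep S M ρ (Metric.ball zs r) s t) ∧
      ∀ t, P.AladinStep S M ρ (Metric.ball zs r) s t → ‖t - p‖ ≤ 1 / 2 * ‖s - p‖ := by
    intro s hs
    rw [mem_ball_iff_norm] at hs
    have hs2 := hnorm s
    have hs1 : ‖s.fst - zs‖ < δ := (abs_le_of_sq_le_sq' (by nlinarith [sq_nonneg ‖s.snd - lams‖])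
      (norm_nonneg _)).2.trans_lt hs
    have hs3 : ‖s.snd - lams‖ < δ := (abs_le_of_sq_le_sq' (by nlinarith [sq_nonneg ‖s.fst - zs‖])
      (norm_nonneg _)).2.trans_lt hs
    obtain ⟨hunique, hcontr⟩ := hstep s.fst s.snd hs1 hs3
    have hpar : ∀ y, P.ParallelStep S M ρ s y ↔ P.HAll y = 0 ∧
        IsLocalMinOn (fun x => ‖P.FAll S M₀ x - c‖ ^ 2 + ⟪s.snd, P.AAll x⟫
          + ρ / 2 * ‖x - s.fst‖ ^ 2) {x | P.HAll x = 0} y := fun y => by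
      rw [P.parallelStep_iff, hFc]
    have hy : ∃! y, y ∈ Metric.ball zs r ∧ P.ParallelStep S M ρ s y := by
      simpa only [hpar] using hunique
    refine ⟨hy, ?_, ?_⟩
    · obtain ⟨y, ⟨hyr, hyp⟩, hyu⟩ := hy
      -- The right-hand side `-P.AAll y` makes `y + D` satisfy the consensus constraint.
      obtain ⟨D, w, k, hD, hAD, hHD⟩ :=
        hreg.exists_kkt (hball hyr) (P.FAll S M₀ y - c) (-P.AAll y)
      refine ⟨WithLp.toLp 2 (y + D, w), ⟨y, hyr, hyp, (hcons y hyr _).2 ⟨k, ?_⟩⟩, ?_⟩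
      · have hfst : (WithLp.toLp 2 (y + D, w) : P.Iterate).fst - y = D := add_sub_cancel_left y D
        rw [hfst, map_add, hAD, add_neg_cancel]
        exact ⟨hD, rfl, hHD⟩
      · rintro t ⟨y', hyr', hyp', ht⟩
        obtain rfl := hyu y' ⟨hyr', hyp'⟩
        obtain ⟨k', hD', hAD', hHD'⟩ := (hcons y' hyr t).1 ht
        -- The difference of two solutions solves the homogeneous system.
        obtain ⟨h1, h2, -⟩ := hreg.kkt_trivial (hball hyr) (D := t.fst - y' - D) (w := t.snd - w)
          (k := k' - k) (fun d => by
            have h1 := hD d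
            have h2 := hD' d
            simp only [map_sub, inner_sub_left] at h1 h2 ⊢
            linarith) (by
            rw [map_sub, hAD, sub_neg_eq_add, add_comm, ← map_add, hAD'])
          (by rw [map_sub, hHD, hHD', sub_zero])
        have h3 : t.fst = y' + D := by
          rw [sub_eq_zero] at h1
          rw [← h1, add_sub_cancel]
        apply (WithLp.equiv 2 _).injective
        exact Prod.ext h3 (sub_eq_zero.1 h2)
    · rintro t ⟨y, hyr, hyp, ht⟩
      obtain ⟨k, hD, hAD, hHD⟩ := (hcons y hyr t).1 ht
      obtain ⟨h1, h2⟩ := hcontr y hyr ((hpar y).1 hyp).1 ((hpar y).1 hyp).2 _ _ k hD hAD hHD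
      rw [add_sub_cancel] at h1
      have ht2 := hnorm t
      have h3 := norm_nonneg (t.fst - zs)
      have h4 := norm_nonneg (t.snd - lams)
      -- With `a`, `b` the two errors of `s`, each error of `t` is at most `(a + b) / 4`. The sum of
      -- their squares is at most `(a + b) ^ 2 / 8 ≤ (a ^ 2 + b ^ 2) / 4`, whence the factor `1 /
      -- 2`.
      refine le_of_sq_le_sq ?_ (by positivity)
      have h5 := pow_le_pow_left₀ (by positivity) h1 2
      have h6 := pow_le_pow_left₀ (by positivity) h2 2
      have h7 := sq_nonneg (‖s.fst - zs‖ - ‖s.snd - lams‖)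
      rw [ht2, mul_pow, hs2]
      linarith
  refine ⟨r, δ, 1 / 2, hr, hδ, by norm_num, by norm_num, hlocal, ?_⟩
  exact existsUnique_orbit_of_contraction (by norm_num) (by norm_num)
    (fun s hs => (hlocal s hs).2.1) fun s hs => (hlocal s hs).2.2
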